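/- Let $\mathcal D$ be a distribution over $(x,y)\in\mathbb R^d\times\{\pm1\}$, let $p,q\in[1,\infty]$ with $1/p+1/q=1$, and assume $\|x\|_p\le 1$ almost surely. For a radius $r\ge 0$ and $w\in\mathbb R^d$ let $$\mathrm{err}^{p,r}(w)=\mathbb P_{(x,y)\sim\mathcal D}\big[\exists x':\ \|x-x'\|_p\le r,\ y\ne\mathrm{sgn}(w^\top x')\big],\qquad \mathsf{OPT}_{p,r}=\min_{\|w\|_q=1}\mathrm{err}^{p,r}(w),$$ where $\mathrm{sgn}$ takes values in $\{\pm1\}$ with $\mathrm{sgn}(0)=1$, and let $\bar v$ with $\|\bar v\|_q=1$ attain the minimum. Let $\phi:\mathbb R\to\mathbb R$ be an $\ell_q$ soft margin function of $\bar v$: $\mathbb P(|\bar v^\top x|\le t)\le\phi(t)$ for all $t\in[0,1]$. Let $\ell:\mathbb R\to[0,\infty)$ be convex, decreasing (not necessarily strictly) and 1-Lipschitz. Let $H=4$ if $p\le 2$ and $H=4d$ if $p>2$. Let $\varepsilon>0$ and $0<\eta\le\varepsilon H^{-1}/4$, and write $\ell^{-1}(\varepsilon)$ for any $z\ge0$ with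 $\ell(z)=\varepsilon$, assumed to exist. Let $\gamma>0$; if $r+\gamma>1$, assume also $\phi(r+\gamma)\ge 1$. Let $\delta>0$ and $n\ge1$. Given a sample $S=\{(x_i,y_i)\}_{i=1}^n\sim\mathcal D^n$, full-batch adversarial training starts from $w_0=0$ and iterates $$w_{k+1}=w_k-\frac{\eta}{n}\sum_{i=1}^n\ell'\big(y_iw_k^\top(x_i+\delta_{i,k})\big)\,y_i\,(x_i+\delta_{i,k}),\qquad \delta_{i,k}\in\arg\max_{\|\delta'\|_p\le r}\ell\big(y_iw_k^\top(x_i+\delta')\big),$$ with any choice of the maximizers and of subgradients $\ell'$ where $\ell$ is not differentiable. Let $$K=d^{\,|2/q-1|}\,\varepsilon^{-1}\eta^{-1}\,\big(\ell^{-1}(\varepsilon)\big)^{2}\gamma^{-2}.$$ Then with probability at least $1-\delta$ over $S$, for every such run of $\lfloor K\rfloor$ iterations, there exists an integer $0\le k^*\le K$ such that $$\begin{aligned}\mathrm{err}^{p,r}(w_{k^*})\le{}&\big(1+(1+r)\,\ell(0)^{-1}\ell^{-1}(\varepsilon)\gamma^{-1}\big)\mathsf{OPT}_{p,r}+\phi(r+\gamma)+2\,\ell(0)^{-1}\varepsilon\\&+4\,\ell(0)^{-1}\bar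 B\gamma^{-1}\ell^{-1}(\varepsilon)\,\mathfrak R_p+\ell(0)^{-1}\Big[\frac{4\bar B\gamma^{-1}\ell^{-1}(\varepsilon)\,r}{\sqrt n}+6B\sqrt{\frac{\log(2\max\{1,K\}/\delta)}{n}}\Big],\end{aligned}$$ where $B=\ell(0)+2d^{|1/q-1/2|}(1+r)\gamma^{-1}\ell^{-1}(\varepsilon)$, $\bar B=2d^{|1/q-1/2|}B$, and $\mathfrak R_p=n^{-1}\,\mathbb E_{\sigma}\big\|\sum_{i=1}^n\sigma_ix_i\big\|_p$ with $\sigma_1,\dots,\sigma_n$ i.i.d. uniform on $\{\pm1\}$. -/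

import Mathlib

open MeasureTheory
open scoped ENNReal

noncomputable section

/-- The `ℓ_p` norm of a vector of `ℝ^d`, for `p ∈ [1, ∞]` (`p = ∞` is the maximum norm). -/
def vecNorm {d : ℕ} (p : ℝ≥0∞) (x : Fin d → ℝ) : ℝ :=
  ‖(WithLp.toLp p x : PiLp p (fun _ : Fin d => ℝ))‖

/-- The sign of a real number, with values in `{+1, -1}`. -/
def sgn (t : ℝ) : ℝ := if 0 ≤ t then 1 else -1

/-- The `ℓ_p` robust error at radius `r` of the halfspace `x ↦ sgn (w · x)`, for a distribution
`D` of labelled examples `(x, y)`. -/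
def robustErr {d : ℕ} (D : Measure ((Fin d → ℝ) × ℝ)) (p : ℝ≥0∞) (r : ℝ) (w : Fin d → ℝ) : ℝ :=
  D.real {s | ∃ x' : Fin d → ℝ, vecNorm p (s.1 - x') ≤ r ∧ s.2 ≠ sgn (w ⬝ᵥ x')}

/-- The best `ℓ_p` robust error at radius `r` of a halfspace with `ℓ_q`-normalized weights. -/
def robustOpt {d : ℕ} (D : Measure ((Fin d → ℝ) × ℝ)) (p q : ℝ≥0∞) (r : ℝ) : ℝ :=
  ⨅ w : {w : Fin d → ℝ // vecNorm q w = 1}, robustErr D p r w.1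

/-- The unit vector `v` satisfies the `ℓ_q` soft margin condition with respect to `φ`. -/
def SoftMargin {d : ℕ} (D : Measure ((Fin d → ℝ) × ℝ)) (q : ℝ≥0∞) (v : Fin d → ℝ)
    (φ : ℝ → ℝ) : Prop :=
  vecNorm q v = 1 ∧ ∀ t ∈ Set.Icc (0 : ℝ) 1, D.real {s | |v ⬝ᵥ s.1| ≤ t} ≤ φ t

/-- `g` is a subgradient of `ℓ` at `a`; for convex `ℓ` this means `g = ℓ' a` wherever `ℓ` is
differentiable. -/
def IsSubgradient (ℓ : ℝ → ℝ) (a g : ℝ) : Prop := ∀ b : ℝ, ℓ a + g * (b - a) ≤ ℓ b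

/-- `w 0, …, w K` are the iterates of `K` steps of full-batch adversarial training with step size
`η` on the sample `S`. In each step every example is perturbed by some maximizer of its loss over
the `ℓ_p` ball of radius `r`, and a gradient step is taken at the perturbed examples, which are
treated as constants. Any choice of maximizers, and of subgradients at kinks of `ℓ`, is allowed. -/
def IsAdvTraining {d n : ℕ} (ℓ : ℝ → ℝ) (p : ℝ≥0∞) (r η : ℝ) (S : Fin n → (Fin d → ℝ) × ℝ)
    (K : ℕ) (w : ℕ → Fin d → ℝ) : Prop :=
  ∀ k < K, ∃ (δ : Fin n → Fin d → ℝ) (g : Fin n → ℝ),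
    (∀ i, vecNorm p (δ i) ≤ r ∧
      ∀ δ' : Fin d → ℝ, vecNorm p δ' ≤ r →
        ℓ ((S i).2 * (w k ⬝ᵥ ((S i).1 + δ'))) ≤ ℓ ((S i).2 * (w k ⬝ᵥ ((S i).1 + δ i)))) ∧
    (∀ i, IsSubgradient ℓ ((S i).2 * (w k ⬝ᵥ ((S i).1 + δ i))) (g i)) ∧
    w (k + 1) = w k - (η / n) • ∑ i, (g i * (S i).2) • ((S i).1 + δ i)

/-- `n⁻¹ 𝔼_σ ‖∑ i, σ_i x_i‖_p`, where the `σ_i` are independent uniform random signs. -/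
def rademacherNorm {d n : ℕ} (p : ℝ≥0∞) (x : Fin n → Fin d → ℝ) : ℝ :=
  (n : ℝ)⁻¹ * (((2 : ℝ) ^ n)⁻¹ *
    ∑ σ : Fin n → Bool, vecNorm p (∑ i, (if σ i then (1 : ℝ) else -1) • x i))

end

/-
For `ℓ_q` dual to `ℓ_p`, the worst perturbation of `x` turns the margin `y (w ⬝ x)` into the robust
margin `y (w ⬝ x) - r ‖w‖_q`. This is the inner product of a feature vector depending only on
`(x, y)` with a weight vector depending only on `w`, in a Euclidean space with one extra coordinate.
So the contraction principle, with a Chernoff bound, controls the excess of the robust risk of `w`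
over that of the comparator `V = (z / γ) v` uniformly over the Euclidean ball around `V` of radius
`‖V‖₂`, outside an event of probability `δ`.

The directions of adversarial training are subgradients of the empirical robust risk. Hence as long
as this risk exceeds that of `V` by more than `ε`, each step brings `w_k` closer to `V` in `ℓ₂`, and
`‖V‖₂² / (η ε)` steps suffice to reach an iterate in that ball whose excess empirical risk is at
most `ε`. Its robust error is at most its robust risk divided by `ℓ 0`. In the robust risk of `V`,
the misclassified examples contribute at most `(ℓ 0 + (1 + r) z / γ) err(v)`, those within `r + γ`
of the hyperplane at most `ℓ 0` times their mass, and all others at most `ℓ z = ε`.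
-/

section Convexity

variable {s : Set ℝ} {f : ℝ → ℝ} {a b c d : ℝ}

theorem map_add_map_le_of_convexOn (hf : ConvexOn ℝ s f) (hc : c ∈ s) (hd : d ∈ s)
    (hda : d ≤ a) (hac : a ≤ c) (h : a + b = c + d) : f a + f b ≤ f c + f d := by
  obtain ⟨α, β, hα, hβ, hαβ, rfl⟩ : a ∈ segment ℝ c d := by
    rw [segment_symm, segment_eq_Icc (hda.trans hac)]
    exact ⟨hda, hac⟩
  have hb : b = β • c + α • d := by
    simp only [smul_eq_mul] at h ⊢
    linear_combination h - (c + d) * hαβ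
  have h₁ := hf.2 hc hd hα hβ hαβ
  have h₂ := hf.2 hc hd hβ hα ((add_comm β α).trans hαβ)
  rw [hb]
  simp only [smul_eq_mul] at h₁ h₂ ⊢
  linear_combination h₁ + h₂ + (f c + f d) * hαβ

theorem map_add_map_le_of_convexOn_of_monotone (hf : ConvexOn ℝ Set.univ f) (hm : Monotone f)
    (ha : a ≤ max c d) (hb : b ≤ max c d) (h : a + b ≤ c + d) : f a + f b ≤ f c + f d := by
  wlog hdc : d ≤ c generalizing c d
  · rw [add_comm (f c)]
    exact this (max_comm c d ▸ ha) (max_comm c d ▸ hb) (add_comm c d ▸ h) (le_of_not_ge hdc)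
  rw [max_eq_left hdc] at ha hb
  rcases le_total b d with hbd | hdb
  · exact add_le_add (hm ha) (hm hbd)
  · calc f a + f b ≤ f (c + d - b) + f b := by gcongr; exact hm (by linarith)
      _ = f b + f (c + d - b) := add_comm _ _
      _ ≤ f c + f d :=
        map_add_map_le_of_convexOn hf (Set.mem_univ _) (Set.mem_univ _) hdb hb (by ring)

end Convexity

section RandomSigns

open scoped BigOperators

theorem expect_signs_succ {n : ℕ} (f : (Fin (n + 1) → ℤˣ) → ℝ) :
    𝔼 σ, f σ = 𝔼 σ : Fin n → ℤˣ, (f (Fin.cons 1 σ) + f (Fin.cons (-1) σ)) / 2 := by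
  have hsum : ∑ σ, f σ = ∑ σ : Fin n → ℤˣ, (f (Fin.cons 1 σ) + f (Fin.cons (-1) σ)) := by
    rw [← (Fin.consEquiv fun _ : Fin (n + 1) => ℤˣ).sum_comp, Fintype.sum_prod_type_right]
    exact Finset.sum_congr rfl fun σ _ => Finset.sum_pair (by decide)
  rw [Fintype.expect_eq_sum_div_card, Fintype.expect_eq_sum_div_card, hsum, ← Finset.sum_div,
    Fintype.card_fun, Fintype.card_fun, Fintype.card_units_int, Fintype.card_fin, Fintype.card_fin]
  push_cast
  rw [pow_succ']
  ring

theorem expect_signs_neg {n : ℕ} (f : (Fin n → ℤˣ) → ℝ) : 𝔼 σ, f (-σ) = 𝔼 σ, f σ :=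
  Fintype.expect_equiv (Equiv.neg _) _ _ fun _ => rfl

section InnerProductSpace

variable {H : Type*} [NormedAddCommGroup H] [InnerProductSpace ℝ H]

theorem cosh_norm_add_add_cosh_norm_sub_le (a x : H) :
    Real.cosh ‖a + x‖ + Real.cosh ‖a - x‖ ≤ 2 * (Real.cosh ‖a‖ * Real.cosh ‖x‖) := by
  have hprod : 2 * (Real.cosh ‖a‖ * Real.cosh ‖x‖)
      = Real.cosh (‖a‖ + ‖x‖) + Real.cosh (‖a‖ - ‖x‖) := by
    rw [Real.cosh_add, Real.cosh_sub]
    ring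
  rw [hprod]
  -- The inequality holds term by term in the power series, as `cosh ‖·‖` is a series in `‖·‖ ^ 2`.
  refine hasSum_le (fun k => ?_) ((Real.hasSum_cosh _).add (Real.hasSum_cosh _))
    ((Real.hasSum_cosh _).add (Real.hasSum_cosh _))
  rw [← add_div, ← add_div]
  refine div_le_div_of_nonneg_right ?_ (by positivity)
  simp only [pow_mul]
  have hadd := norm_add_sq_real a x
  have hsub := norm_sub_sq_real a x
  have hinner := abs_le.1 (abs_real_inner_le_norm a x)
  exact map_add_map_le_of_convexOn (convexOn_pow k) (Set.mem_Ici.2 (sq_nonneg _))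
    (Set.mem_Ici.2 (sq_nonneg _)) (by nlinarith) (by nlinarith) (by nlinarith)

theorem expect_cosh_norm_add_sum_le {n : ℕ} (x : Fin n → H) (a : H) :
    𝔼 σ : Fin n → ℤˣ, Real.cosh ‖a + ∑ i, σ i • x i‖
      ≤ Real.cosh ‖a‖ * ∏ i, Real.cosh ‖x i‖ := by
  induction n generalizing a with
  | zero => simp
  | succ n ih =>
    have hP : 0 ≤ ∏ i : Fin n, Real.cosh ‖x i.succ‖ :=
      Finset.prod_nonneg fun i _ => (Real.cosh_pos _).le
    rw [expect_signs_succ, ← Finset.expect_div, Finset.expect_add_distrib, Fin.prod_univ_succ]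
    simp only [Fin.sum_univ_succ, Fin.cons_zero, Fin.cons_succ, one_smul, Units.neg_smul,
      ← add_assoc, ← sub_eq_add_neg]
    have hplus := ih (fun i => x i.succ) (a + x 0)
    have hminus := ih (fun i => x i.succ) (a - x 0)
    have hfirst := mul_le_mul_of_nonneg_right (cosh_norm_add_add_cosh_norm_sub_le a (x 0)) hP
    linarith

theorem expect_exp_norm_sum_le {n : ℕ} (x : Fin n → H) :
    𝔼 σ : Fin n → ℤˣ, Real.exp ‖∑ i, σ i • x i‖ ≤ 2 * Real.exp ((∑ i, ‖x i‖ ^ 2) / 2) := by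
  have hexp : ∀ t : ℝ, Real.exp t ≤ 2 * Real.cosh t := fun t => by
    rw [Real.cosh_eq]
    linarith [Real.exp_pos (-t)]
  calc 𝔼 σ : Fin n → ℤˣ, Real.exp ‖∑ i, σ i • x i‖
      ≤ 𝔼 σ : Fin n → ℤˣ, 2 * Real.cosh ‖0 + ∑ i, σ i • x i‖ :=
        Finset.expect_le_expect fun σ _ => by rw [zero_add]; exact hexp _
    _ = 2 * 𝔼 σ : Fin n → ℤˣ, Real.cosh ‖0 + ∑ i, σ i • x i‖ := (Finset.mul_expect _ _ _).symm
    _ ≤ 2 * ∏ i, Real.cosh ‖x i‖ := by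
        have := expect_cosh_norm_add_sum_le x 0
        rw [norm_zero, Real.cosh_zero, one_mul] at this
        gcongr
    _ ≤ 2 * ∏ i, Real.exp (‖x i‖ ^ 2 / 2) := by
        gcongr with i
        exact Real.cosh_le_exp_half_sq _
    _ = 2 * Real.exp ((∑ i, ‖x i‖ ^ 2) / 2) := by rw [← Real.exp_sum, Finset.sum_div]

end InnerProductSpace

section Contraction

variable {ι : Type*} {F : Finset ι} (hF : F.Nonempty) {Φ : ℝ → ℝ}

theorem map_sup'_add_map_sup'_le_of_abs_sub_le (hΦ : ConvexOn ℝ Set.univ Φ) (hΦm : Monotone Φ)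
    (a f g : ι → ℝ) (h₀ : ∀ j ∈ F, |f j| ≤ |g j|)
    (h : ∀ j ∈ F, ∀ k ∈ F, |f j - f k| ≤ |g j - g k|) :
    Φ (F.sup' hF fun j => a j + f j) + Φ (F.sup' hF fun j => a j - f j)
      ≤ Φ (F.sup' hF fun j => a j + g j) + Φ (F.sup' hF fun j => a j - g j) := by
  set M := F.sup' hF fun j => a j + g j
  set N := F.sup' hF fun j => a j - g j
  have hM : ∀ j ∈ F, a j + g j ≤ M := fun j hj => F.le_sup' (fun j => a j + g j) hj
  have hN : ∀ j ∈ F, a j - g j ≤ N := fun j hj => F.le_sup' (fun j => a j - g j) hj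
  have hmax : ∀ j ∈ F, a j + |f j| ≤ max M N := fun j hj => by
    refine (add_le_add_right (h₀ j hj) _).trans ?_
    rcases abs_cases (g j) with ⟨hg, -⟩ | ⟨hg, -⟩ <;> rw [hg]
    · exact (hM j hj).trans (le_max_left M N)
    · exact (hN j hj).trans (le_max_right M N)
  obtain ⟨j, hj, hj_eq⟩ := F.exists_mem_eq_sup' hF fun j => a j + f j
  obtain ⟨k, hk, hk_eq⟩ := F.exists_mem_eq_sup' hF fun j => a j - f j
  rw [hj_eq, hk_eq]
  refine map_add_map_le_of_convexOn_of_monotone hΦ hΦm ?_ ?_ ?_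
  · linarith [hmax j hj, le_abs_self (f j)]
  · linarith [hmax k hk, neg_abs_le (f k)]
  · have hjk := (le_abs_self _).trans (h j hj k hk)
    rcases abs_cases (g j - g k) with ⟨hg, -⟩ | ⟨hg, -⟩
    · linarith [hM j hj, hN k hk]
    · linarith [hM k hk, hN j hj]

/-- The Ledoux–Talagrand contraction principle. -/
theorem expect_map_sup'_add_sum_le_of_abs_sub_le (hΦ : ConvexOn ℝ Set.univ Φ)
    (hΦm : Monotone Φ) {n : ℕ} (a : ι → ℝ) (f g : ι → Fin n → ℝ)
    (h₀ : ∀ i, ∀ j ∈ F, |f j i| ≤ |g j i|)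
    (h : ∀ i, ∀ j ∈ F, ∀ k ∈ F, |f j i - f k i| ≤ |g j i - g k i|) :
    𝔼 σ : Fin n → ℤˣ, Φ (F.sup' hF fun j => a j + ∑ i, σ i • f j i)
      ≤ 𝔼 σ : Fin n → ℤˣ, Φ (F.sup' hF fun j => a j + ∑ i, σ i • g j i) := by
  induction n generalizing a with
  | zero => simp
  | succ n ih =>
    rw [expect_signs_succ, expect_signs_succ]
    simp only [← Finset.expect_div, Fin.sum_univ_succ, Fin.cons_zero, Fin.cons_succ, one_smul,
      Units.neg_smul, ← add_assoc, ← sub_eq_add_neg]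
    refine div_le_div_of_nonneg_right ?_ zero_le_two
    have hstep : ∀ σ : Fin n → ℤˣ, _ := fun σ =>
      map_sup'_add_map_sup'_le_of_abs_sub_le hF hΦ hΦm (fun j => a j + ∑ i, σ i • g j i.succ)
        (fun j => f j 0) (fun j => g j 0) (h₀ 0) (h 0)
    simp only [add_right_comm _ (∑ _, _), add_sub_right_comm] at hstep
    refine le_trans ?_ (Finset.expect_le_expect fun σ _ => hstep σ)
    rw [Finset.expect_add_distrib, Finset.expect_add_distrib]
    exact add_le_add
      (ih (fun j => a j + f j 0) (fun j i => f j i.succ) (fun j i => g j i.succ)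
        (fun i => h₀ i.succ) fun i => h i.succ)
      (ih (fun j => a j - f j 0) (fun j i => f j i.succ) (fun j i => g j i.succ)
        (fun i => h₀ i.succ) fun i => h i.succ)

end Contraction

theorem abs_sub_le_of_lipschitzWith_one {ψ : ℝ → ℝ} (hψ : LipschitzWith 1 ψ) (a b : ℝ) :
    |ψ a - ψ b| ≤ |a - b| := by
  simpa [Real.dist_eq] using hψ.dist_le_mul a b

theorem expect_exp_sup'_lipschitz_inner_sub_le {H ι : Type*} [NormedAddCommGroup H]
    [InnerProductSpace ℝ H] {n : ℕ} {F : Finset ι} (hF : F.Nonempty) {V : H} {W : ι → H} {ρ R c : ℝ}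
    (hc : 0 ≤ c) (hρ : ∀ j ∈ F, ‖W j - V‖ ≤ ρ) (x : Fin n → H) (hx : ∀ i, ‖x i‖ ≤ R) {ψ : ℝ → ℝ}
    (hψ : LipschitzWith 1 ψ) :
    𝔼 σ : Fin n → ℤˣ, Real.exp (F.sup' hF fun j =>
        ∑ i, σ i • (c * (ψ (inner ℝ (W j) (x i)) - ψ (inner ℝ V (x i)))))
      ≤ 2 * Real.exp (n * (c * (ρ * R)) ^ 2 / 2) := by
  have hρ₀ : 0 ≤ ρ := hF.elim fun j hj => (norm_nonneg _).trans (hρ j hj)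
  have hcontr := expect_map_sup'_add_sum_le_of_abs_sub_le hF convexOn_exp Real.exp_monotone
    (fun _ => 0) (fun j i => c * (ψ (inner ℝ (W j) (x i)) - ψ (inner ℝ V (x i))))
    (fun j i => c * inner ℝ (W j - V) (x i))
    (fun i j _ => by
      simp only [abs_mul, inner_sub_left]
      exact mul_le_mul_of_nonneg_left (abs_sub_le_of_lipschitzWith_one hψ _ _) (abs_nonneg c))
    (fun i j _ k _ => by
      simp only [← mul_sub, abs_mul, inner_sub_left, sub_sub_sub_cancel_right]
      exact mul_le_mul_of_nonneg_left (abs_sub_le_of_lipschitzWith_one hψ _ _) (abs_nonneg c))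
  simp only [zero_add] at hcontr
  have hinner : ∀ σ : Fin n → ℤˣ, ∀ j ∈ F,
      ∑ i, σ i • (c * inner ℝ (W j - V) (x i)) ≤ ‖∑ i, σ i • (c * ρ) • x i‖ := fun σ j hj => by
    have hl : ∑ i, σ i • (c * inner ℝ (W j - V) (x i))
        = c * inner ℝ (W j - V) (∑ i, σ i • x i) := by
      simp only [inner_sum, Finset.mul_sum, Units.smul_def, inner_smul_right_eq_smul, mul_smul_comm]
    have hr : ∑ i, σ i • (c * ρ) • x i = (c * ρ) • ∑ i, σ i • x i := by
      rw [Finset.smul_sum]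
      exact Finset.sum_congr rfl fun i _ => smul_comm _ _ _
    rw [hl, hr, norm_smul, Real.norm_of_nonneg (by positivity), mul_assoc]
    gcongr
    exact (real_inner_le_norm _ _).trans (by gcongr; exact hρ j hj)
  refine hcontr.trans <| (Finset.expect_le_expect fun σ _ => Real.exp_le_exp.2 <|
    Finset.sup'_le _ _ (hinner σ)).trans <| (expect_exp_norm_sum_le _).trans ?_
  gcongr
  have hterm : ∀ i, ‖(c * ρ) • x i‖ ^ 2 ≤ (c * (ρ * R)) ^ 2 := fun i => by
    rw [norm_smul, Real.norm_of_nonneg (by positivity), ← mul_assoc]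
    gcongr
    exact hx i
  simpa using Finset.sum_le_sum fun i (_ : i ∈ Finset.univ) => hterm i

end RandomSigns

/-- The generalization gap of `g` on the sample `S`: its mean under `D` minus its empirical mean. -/
noncomputable def generalizationGap {Z : Type*} [MeasurableSpace Z] (D : Measure Z) {n : ℕ}
    (S : Fin n → Z) (g : Z → ℝ) : ℝ :=
  ∫ s, g s ∂D - (n : ℝ)⁻¹ * ∑ i, g (S i)

section Symmetrization

open scoped BigOperators

variable {Z ι : Type*} [MeasurableSpace Z] {D : Measure Z}

theorem generalizationGap_const_mul {n : ℕ} (S : Fin n → Z) (c : ℝ) (g : Z → ℝ) :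
    generalizationGap D S (fun s => c * g s) = c * generalizationGap D S g := by
  rw [generalizationGap, generalizationGap, integral_const_mul, ← Finset.mul_sum]
  ring

variable [IsProbabilityMeasure D] {F : Finset ι} (hF : F.Nonempty)

theorem integrable_exp_of_le {g : Z → ℝ} {C : ℝ} (hg : Measurable g) (hC : ∀ s, g s ≤ C) :
    Integrable (fun s => Real.exp (g s)) D :=
  .of_bound hg.exp.aestronglyMeasurable (Real.exp C) <| .of_forall fun s => by
    rw [Real.norm_of_nonneg (Real.exp_pos _).le]
    exact Real.exp_le_exp.2 (hC s)

theorem integrable_exp_sup' {g : ι → Z → ℝ} {C : ℝ} (hg : ∀ j, Measurable (g j))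
    (hC : ∀ j s, g j s ≤ C) : Integrable (fun s => Real.exp (F.sup' hF fun j => g j s)) D := by
  have hsup : Measurable fun s => F.sup' hF fun j => g j s := by
    simpa only [← Finset.sup'_apply] using F.measurable_sup' hF fun j _ => hg j
  exact integrable_exp_of_le hsup fun s => Finset.sup'_le _ _ fun j _ => hC j s

theorem measurePreserving_swap_of_signs {n : ℕ} (σ : Fin n → ℤˣ) :
    MeasurePreserving (fun (u : Fin n → Z × Z) i => if σ i = 1 then u i else (u i).swap)
      (Measure.pi fun _ => D.prod D) (Measure.pi fun _ => D.prod D) := by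
  refine measurePreserving_pi (fun _ => D.prod D) (fun _ => D.prod D)
    (f := fun i u => if σ i = 1 then u else u.swap) fun i => ?_
  split_ifs
  · exact MeasurePreserving.id (D.prod D)
  · exact Measure.measurePreserving_swap

theorem expect_exp_sup'_sub_le {n : ℕ} (f g : ι → Fin n → ℝ) {A : ℝ}
    (hf : 𝔼 σ : Fin n → ℤˣ, Real.exp (F.sup' hF fun j => ∑ i, σ i • (2 * f j i)) ≤ A)
    (hg : 𝔼 σ : Fin n → ℤˣ, Real.exp (F.sup' hF fun j => ∑ i, σ i • (2 * g j i)) ≤ A) :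
    𝔼 σ : Fin n → ℤˣ, Real.exp (F.sup' hF fun j => ∑ i, σ i • (f j i - g j i)) ≤ A := by
  set a : (Fin n → ℤˣ) → ℝ := fun σ => F.sup' hF fun j => ∑ i, σ i • (2 * f j i)
  set b : (Fin n → ℤˣ) → ℝ := fun σ => F.sup' hF fun j => ∑ i, σ i • (2 * g j i)
  have hsup : ∀ σ : Fin n → ℤˣ,
      F.sup' hF (fun j => ∑ i, σ i • (f j i - g j i)) ≤ (1 / 2) * a σ + (1 / 2) * b (-σ) := by
    refine fun σ => Finset.sup'_le _ _ fun j hj => ?_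
    have ha : ∑ i, σ i • (2 * f j i) ≤ a σ := F.le_sup' (fun j => ∑ i, σ i • (2 * f j i)) hj
    have hb : ∑ i, (-σ) i • (2 * g j i) ≤ b (-σ) :=
      F.le_sup' (fun j => ∑ i, (-σ) i • (2 * g j i)) hj
    simp only [two_mul, smul_add, Finset.sum_add_distrib, Pi.neg_apply, Units.neg_smul,
      Finset.sum_neg_distrib] at ha hb
    simp only [smul_sub, Finset.sum_sub_distrib]
    linarith
  have hexp : ∀ σ : Fin n → ℤˣ, Real.exp (F.sup' hF fun j => ∑ i, σ i • (f j i - g j i))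
      ≤ (1 / 2) * Real.exp (a σ) + (1 / 2) * Real.exp (b (-σ)) := fun σ =>
    (Real.exp_le_exp.2 (hsup σ)).trans <|
      convexOn_exp.2 (Set.mem_univ _) (Set.mem_univ _) (by norm_num) (by norm_num) (by norm_num)
  refine (Finset.expect_le_expect fun σ _ => hexp σ).trans ?_
  rw [Finset.expect_add_distrib, ← Finset.mul_expect, ← Finset.mul_expect,
    expect_signs_neg fun σ => Real.exp (b σ)]
  linarith

variable {n : ℕ} {f : ι → Z → ℝ} {C A : ℝ}

theorem integral_exp_sup'_sum_sub_le (hf : ∀ j, Measurable (f j)) (hC : ∀ j s, |f j s| ≤ C)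
    (hA : ∀ S : Fin n → Z, 𝔼 σ : Fin n → ℤˣ,
      Real.exp (F.sup' hF fun j => ∑ i, σ i • (2 * f j (S i))) ≤ A) :
    ∫ u : Fin n → Z × Z, Real.exp (F.sup' hF fun j => ∑ i, (f j (u i).2 - f j (u i).1))
      ∂(Measure.pi fun _ => D.prod D) ≤ A := by
  set P : Measure (Fin n → Z × Z) := Measure.pi fun _ => D.prod D
  set Ψ : (Fin n → ℤˣ) → (Fin n → Z × Z) → ℝ := fun σ u =>
    Real.exp (F.sup' hF fun j => ∑ i, σ i • (f j (u i).2 - f j (u i).1))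
  have hint : ∀ σ, Integrable (Ψ σ) P := fun σ => by
    refine integrable_exp_sup' hF (C := ∑ _i : Fin n, 2 * C) (fun j => ?_) fun j u => ?_
    · exact Finset.measurable_fun_sum _ fun i _ => Measurable.const_smul (by fun_prop) _
    · gcongr with i
      have h₁ := abs_le.1 (hC j (u i).1)
      have h₂ := abs_le.1 (hC j (u i).2)
      rcases Int.units_eq_one_or (σ i) with hσ | hσ <;> rw [hσ]
      · rw [one_smul]; linarith
      · rw [Units.neg_smul, one_smul]; linarith
  have hswap : ∀ σ, ∫ u, Ψ σ u ∂P = ∫ u, Ψ 1 u ∂P := fun σ => by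
    have hσ : MeasurePreserving _ P P := measurePreserving_swap_of_signs σ
    have hmap := integral_map hσ.measurable.aemeasurable (f := Ψ 1)
      (by rw [hσ.map_eq]; exact (hint 1).aestronglyMeasurable)
    rw [hσ.map_eq] at hmap
    rw [hmap]
    refine integral_congr_ae (Filter.Eventually.of_forall fun u => ?_)
    simp only [Ψ, Pi.one_apply, one_smul]
    refine congrArg Real.exp
      (Finset.sup'_congr hF rfl fun j _ => Finset.sum_congr rfl fun i _ => ?_)
    rcases Int.units_eq_one_or (σ i) with h | h <;> simp [h]
  calc ∫ u, Real.exp (F.sup' hF fun j => ∑ i, (f j (u i).2 - f j (u i).1)) ∂P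
      = 𝔼 σ : Fin n → ℤˣ, ∫ u, Ψ σ u ∂P := by
        simp only [hswap, Fintype.expect_const, Ψ, Pi.one_apply, one_smul]
    _ = ∫ u, 𝔼 σ : Fin n → ℤˣ, Ψ σ u ∂P := by
        simp only [Fintype.expect_eq_sum_div_card, integral_div,
          integral_finsetSum _ fun σ _ => hint σ]
    _ ≤ ∫ _u, A ∂P := by
        refine integral_mono ?_ (integrable_const A) fun u =>
          expect_exp_sup'_sub_le hF _ _ (hA fun i => (u i).2) (hA fun i => (u i).1)
        simp only [Fintype.expect_eq_sum_div_card]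
        exact (integrable_finsetSum _ fun σ _ => hint σ).div_const _
    _ = A := by rw [integral_const, probReal_univ, one_smul]

theorem mul_generalizationGap_eq_integral {g : Z → ℝ} (hg : Integrable g D) (S : Fin n → Z) :
    n * generalizationGap D S g
      = ∫ S', ∑ i, (g (S' i) - g (S i)) ∂(Measure.pi fun _ : Fin n => D) := by
  have hint : ∀ i, Integrable (fun S' : Fin n → Z => g (S' i)) (Measure.pi fun _ => D) :=
    fun i => integrable_comp_eval hg
  have hsub : ∀ i, Integrable (fun S' : Fin n → Z => g (S' i) - g (S i)) (Measure.pi fun _ => D) :=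
    fun i => (hint i).sub (integrable_const _)
  rw [integral_finsetSum _ fun i _ => hsub i]
  simp only [integral_sub (hint _) (integrable_const _), integral_const, probReal_univ, one_smul,
    integral_comp_eval (μ := fun _ : Fin n => D) hg.aestronglyMeasurable, Finset.sum_sub_distrib,
    Finset.sum_const, Finset.card_univ, Fintype.card_fin, nsmul_eq_mul, generalizationGap]
  rcases eq_or_ne n 0 with rfl | hn
  · simp
  · field_simp

theorem abs_sum_sub_le {a b : Fin n → ℝ} (ha : ∀ i, |a i| ≤ C) (hb : ∀ i, |b i| ≤ C) :
    |∑ i, (a i - b i)| ≤ n * (2 * C) := by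
  calc |∑ i, (a i - b i)| ≤ ∑ i, |a i - b i| := Finset.abs_sum_le_sum_abs _ _
    _ ≤ ∑ _i : Fin n, 2 * C := by
        gcongr with i
        linarith [abs_sub (a i) (b i), ha i, hb i]
    _ = n * (2 * C) := by simp

theorem exp_mul_generalizationGap_le_integral {g : Z → ℝ} (hg : Measurable g)
    (hC : ∀ s, |g s| ≤ C) (S : Fin n → Z) :
    Real.exp (n * generalizationGap D S g)
      ≤ ∫ S', Real.exp (∑ i, (g (S' i) - g (S i))) ∂(Measure.pi fun _ : Fin n => D) := by
  have hbound : ∀ S' : Fin n → Z, |∑ i, (g (S' i) - g (S i))| ≤ n * (2 * C) := fun S' =>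
    abs_sum_sub_le (fun i => hC (S' i)) fun i => hC (S i)
  have hmeas : Measurable fun S' : Fin n → Z => ∑ i, (g (S' i) - g (S i)) := by fun_prop
  rw [mul_generalizationGap_eq_integral (.of_bound hg.aestronglyMeasurable C (.of_forall hC))]
  exact convexOn_exp.map_integral_le Real.continuous_exp.continuousOn isClosed_univ
    (.of_forall fun _ => Set.mem_univ _)
    (.of_bound hmeas.aestronglyMeasurable _ (.of_forall hbound))
    (integrable_exp_of_le hmeas fun S' => (abs_le.1 (hbound S')).2)

/-- The sample is compared with an independent ghost sample, which Jensen's inequality introduces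
in place of the mean. -/
theorem measureReal_exists_le_mul_generalizationGap_le (hf : ∀ j, Measurable (f j))
    (hC : ∀ j s, |f j s| ≤ C)
    (hA : ∀ S : Fin n → Z, 𝔼 σ : Fin n → ℤˣ,
      Real.exp (F.sup' hF fun j => ∑ i, σ i • (2 * f j (S i))) ≤ A) (t : ℝ) :
    (Measure.pi fun _ : Fin n => D).real {S | ∃ j ∈ F, t ≤ n * generalizationGap D S (f j)}
      ≤ Real.exp (-t) * A := by
  set P : Measure (Fin n → Z) := Measure.pi fun _ => D
  set Ψ : (Fin n → Z) × (Fin n → Z) → ℝ := fun u =>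
    Real.exp (F.sup' hF fun j => ∑ i, (f j (u.2 i) - f j (u.1 i)))
  have hle : ∀ j (S S' : Fin n → Z), ∑ i, (f j (S' i) - f j (S i)) ≤ n * (2 * C) :=
    fun j S S' => (abs_le.1 (abs_sum_sub_le (fun i => hC j (S' i)) fun i => hC j (S i))).2
  have hΨ : Integrable Ψ (P.prod P) :=
    integrable_exp_sup' hF (fun j => by fun_prop) fun j u => hle j u.1 u.2
  have hint : ∫ S, ∫ S', Ψ (S, S') ∂P ∂P ≤ A := by
    have hp := measurePreserving_arrowProdEquivProdArrow Z Z (Fin n) (fun _ => D) fun _ => D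
    rw [← integral_prod _ hΨ, ← hp.integral_comp (MeasurableEquiv.measurableEmbedding _)]
    exact integral_exp_sup'_sum_sub_le hF hf hC hA
  have hJensen : ∀ S, ∀ j ∈ F,
      Real.exp (n * generalizationGap D S (f j)) ≤ ∫ S', Ψ (S, S') ∂P := fun S j hj =>
    (exp_mul_generalizationGap_le_integral (hf j) (hC j) S).trans <|
      integral_mono (integrable_exp_of_le (by fun_prop) (hle j S))
        (integrable_exp_sup' hF (fun k => by fun_prop) fun k S' => hle k S S') fun S' =>
        Real.exp_le_exp.2 (F.le_sup' (fun k => ∑ i, (f k (S' i) - f k (S i))) hj)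
  have hMarkov := mul_meas_ge_le_integral_of_nonneg
    (.of_forall fun S => integral_nonneg fun S' => (Real.exp_pos _).le) hΨ.integral_prod_left
    (Real.exp t)
  rw [Real.exp_neg, inv_mul_eq_div, le_div_iff₀' (Real.exp_pos t)]
  refine le_trans (mul_le_mul_of_nonneg_left (measureReal_mono ?_) (Real.exp_pos t).le)
    (hMarkov.trans hint)
  rintro S ⟨j, hj, hjt⟩
  exact (Real.exp_le_exp.2 hjt).trans (hJensen _ j hj)

end Symmetrization

/-- The excess of the loss `ψ ⟪W, x⟫` of a linear predictor `W` over that of a reference predictor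
`V`, at an example `s` with feature vector `x = X s`. -/
noncomputable def excessLoss {Z H : Type*} [NormedAddCommGroup H] [InnerProductSpace ℝ H]
    (ψ : ℝ → ℝ) (X : Z → H) (V W : H) (s : Z) : ℝ :=
  ψ (inner ℝ W (X s)) - ψ (inner ℝ V (X s))

section UniformDeviation

variable {Z H : Type*} [NormedAddCommGroup H] [InnerProductSpace ℝ H] {ψ : ℝ → ℝ} {X : Z → H}
  {V : H} {ρ R : ℝ}

theorem abs_excessLoss_le (hψ : LipschitzWith 1 ψ) {W : H} {s : Z} (hW : ‖W - V‖ ≤ ρ)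
    (hR : ‖X s‖ ≤ R) : |excessLoss ψ X V W s| ≤ ρ * R := by
  calc |excessLoss ψ X V W s| ≤ |inner ℝ W (X s) - inner ℝ V (X s)| :=
        abs_sub_le_of_lipschitzWith_one hψ _ _
    _ = |inner ℝ (W - V) (X s)| := by rw [inner_sub_left]
    _ ≤ ‖W - V‖ * ‖X s‖ := abs_real_inner_le_norm _ _
    _ ≤ ρ * R := mul_le_mul hW hR (norm_nonneg _) ((norm_nonneg _).trans hW)

variable [MeasurableSpace Z] {D : Measure Z}

theorem measurable_excessLoss (hψ : LipschitzWith 1 ψ) (hX : StronglyMeasurable X) (W : H) :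
    Measurable (excessLoss ψ X V W) := by
  have hcomp : ∀ U : H, Measurable fun s => ψ (inner ℝ U (X s)) := fun U =>
    hψ.continuous.measurable.comp (stronglyMeasurable_const.inner hX).measurable
  exact (hcomp W).sub (hcomp V)

variable [IsProbabilityMeasure D] {n : ℕ} {t : ℝ}

theorem measureReal_exists_le_generalizationGap_excessLoss_le (hψ : LipschitzWith 1 ψ)
    (hX : StronglyMeasurable X) (hR : ∀ s, ‖X s‖ ≤ R) {ι : Type*} (F : Finset ι) {W : ι → H}
    (hW : ∀ j, ‖W j - V‖ ≤ ρ) (hG : 0 < ρ * R) (ht : 0 ≤ t) :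
    (Measure.pi fun _ : Fin n => D).real
        {S | ∃ j ∈ F, t ≤ generalizationGap D S (excessLoss ψ X V (W j))}
      ≤ 2 * Real.exp (-(n * t ^ 2 / (8 * (ρ * R) ^ 2))) := by
  rcases F.eq_empty_or_nonempty with rfl | hF
  · simp only [Finset.notMem_empty, false_and, exists_false, Set.ofPred_false, measureReal_empty]
    positivity
  -- The Chernoff parameter: it minimizes `2 * n * (c * G) ^ 2 - n * c * t` with `G = ρ * R`.
  set c := t / (4 * (ρ * R) ^ 2) with hc
  have hc₀ : 0 ≤ c := by positivity
  have hmoment : ∀ S : Fin n → Z, _ := fun S =>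
    expect_exp_sup'_lipschitz_inner_sub_le hF (mul_nonneg zero_le_two hc₀) (fun j _ => hW j)
      (fun i => X (S i)) (fun i => hR _) hψ
  have htail := measureReal_exists_le_mul_generalizationGap_le (D := D) hF (C := c * (ρ * R))
    (f := fun j s => c * excessLoss ψ X V (W j) s)
    (fun j => (measurable_excessLoss hψ hX _).const_mul c)
    (fun j s => by
      rw [abs_mul, abs_of_nonneg hc₀]
      exact mul_le_mul_of_nonneg_left (abs_excessLoss_le hψ (hW j) (hR s)) hc₀)
    (fun S => by simpa only [excessLoss, mul_assoc] using hmoment S) (n * (c * t))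
  refine le_trans (measureReal_mono ?_) (htail.trans_eq ?_)
  · rintro S ⟨j, hj, hjt⟩
    refine ⟨j, hj, ?_⟩
    rw [generalizationGap_const_mul]
    gcongr
  · rw [mul_left_comm, ← Real.exp_add, hc]
    congr 2
    field_simp
    ring

theorem continuous_generalizationGap_excessLoss (hψ : LipschitzWith 1 ψ)
    (hX : StronglyMeasurable X) (hR : ∀ s, ‖X s‖ ≤ R) (S : Fin n → Z) :
    Continuous fun W : Metric.closedBall V ρ => generalizationGap D S (excessLoss ψ X V W) := by
  have hcont : ∀ s, Continuous fun W : Metric.closedBall V ρ => excessLoss ψ X V W s := fun s =>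
    (hψ.continuous.comp (continuous_subtype_val.inner continuous_const)).sub continuous_const
  refine Continuous.sub ?_ (continuous_const.mul (continuous_finsetSum _ fun i _ => hcont (S i)))
  exact continuous_of_dominated (bound := fun _ => ρ * R)
    (fun W => (measurable_excessLoss hψ hX _).aestronglyMeasurable)
    (fun W => .of_forall fun s => abs_excessLoss_le hψ (mem_closedBall_iff_norm.1 W.2) (hR s))
    (integrable_const _) (.of_forall hcont)

variable [TopologicalSpace.SeparableSpace H]

theorem measureReal_exists_lt_generalizationGap_excessLoss_le (hψ : LipschitzWith 1 ψ)
    (hX : StronglyMeasurable X) (hR : ∀ s, ‖X s‖ ≤ R) (hρ : 0 ≤ ρ) (hG : 0 < ρ * R) (ht : 0 ≤ t) :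
    (Measure.pi fun _ : Fin n => D).real
        {S | ∃ W, ‖W - V‖ ≤ ρ ∧ t < generalizationGap D S (excessLoss ψ X V W)}
      ≤ 2 * Real.exp (-(n * t ^ 2 / (8 * (ρ * R) ^ 2))) := by
  have : SecondCountableTopology H := UniformSpace.secondCountable_of_separable H
  have : Nonempty (Metric.closedBall V ρ) := ⟨⟨V, Metric.mem_closedBall_self hρ⟩⟩
  set P : Measure (Fin n → Z) := Measure.pi fun _ => D
  set u := TopologicalSpace.denseSeq (Metric.closedBall V ρ)
  set bad : ℕ → Set (Fin n → Z) := fun m =>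
    {S | ∃ j ∈ Finset.range m, t ≤ generalizationGap D S (excessLoss ψ X V (u j))}
  have hbad : ∀ m, P.real (bad m) ≤ 2 * Real.exp (-(n * t ^ 2 / (8 * (ρ * R) ^ 2))) := fun m =>
    measureReal_exists_le_generalizationGap_excessLoss_le hψ hX hR _
      (fun j => mem_closedBall_iff_norm.1 (u j).2) hG ht
  have hmono : Monotone bad := fun a b hab S ⟨j, hj, hjt⟩ =>
    ⟨j, Finset.range_mono hab hj, hjt⟩
  have hsub : {S | ∃ W, ‖W - V‖ ≤ ρ ∧ t < generalizationGap D S (excessLoss ψ X V W)}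
      ⊆ ⋃ m, bad m := by
    rintro S ⟨W, hW, hWt⟩
    have hopen : IsOpen {W : Metric.closedBall V ρ |
        t < generalizationGap D S (excessLoss ψ X V W)} :=
      isOpen_lt continuous_const (continuous_generalizationGap_excessLoss hψ hX hR S)
    obtain ⟨j, hj⟩ := (TopologicalSpace.denseRange_denseSeq _).exists_mem_open hopen
      ⟨⟨W, mem_closedBall_iff_norm.2 hW⟩, hWt⟩
    exact Set.mem_iUnion.2 ⟨j + 1, j, Finset.self_mem_range_succ j, le_of_lt hj⟩
  refine (measureReal_mono hsub).trans ?_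
  rw [Measure.real, hmono.measure_iUnion]
  refine ENNReal.toReal_le_of_le_ofReal (by positivity) (iSup_le fun m => ?_)
  exact (ENNReal.le_ofReal_iff_toReal_le (measure_ne_top _ _) (by positivity)).2 (hbad m)

theorem ae_pi_forall {Q : Z → Prop} (h : ∀ᵐ s ∂D, Q s) :
    ∀ᵐ S ∂(Measure.pi fun _ : Fin n => D), ∀ i, Q (S i) :=
  ae_all_iff.2 fun i => (Measure.quasiMeasurePreserving_eval (fun _ => D) i).ae h

theorem measureReal_exists_lt_generalizationGap_excessLoss_le_of_ae (hψ : LipschitzWith 1 ψ)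
    (hX : StronglyMeasurable X) (hR : ∀ᵐ s ∂D, ‖X s‖ ≤ R) (hρ : 0 ≤ ρ) (hG : 0 < ρ * R)
    (ht : 0 ≤ t) :
    (Measure.pi fun _ : Fin n => D).real
        {S | ∃ W, ‖W - V‖ ≤ ρ ∧ t < generalizationGap D S (excessLoss ψ X V W)}
      ≤ 2 * Real.exp (-(n * t ^ 2 / (8 * (ρ * R) ^ 2))) := by
  set B : Set Z := {s | ‖X s‖ ≤ R}
  have hB : MeasurableSet B := hX.norm.measurable measurableSet_Iic
  have hR₀ : 0 ≤ R := (pos_of_mul_pos_right hG hρ).le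
  have hbound : ∀ s, ‖B.indicator X s‖ ≤ R := fun s => by
    by_cases hs : s ∈ B
    · rwa [Set.indicator_of_mem hs]
    · rwa [Set.indicator_of_notMem hs, norm_zero]
  have heq : ∀ {s}, s ∈ B → ∀ W, excessLoss ψ (B.indicator X) V W s = excessLoss ψ X V W s :=
    fun hs W => by rw [excessLoss, excessLoss, Set.indicator_of_mem hs]
  refine le_trans (le_of_eq (measureReal_congr ?_))
    (measureReal_exists_lt_generalizationGap_excessLoss_le (V := V) hψ (hX.indicator hB) hbound
      hρ hG ht)
  filter_upwards [ae_pi_forall hR] with S hS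
  have hgap : ∀ W, generalizationGap D S (excessLoss ψ (B.indicator X) V W)
      = generalizationGap D S (excessLoss ψ X V W) := fun W => by
    rw [generalizationGap, generalizationGap, integral_congr_ae (hR.mono fun s hs => heq hs W),
      Finset.sum_congr rfl fun i _ => heq (hS i) W]
  exact propext (exists_congr fun W => by rw [hgap])

theorem measureReal_exists_sqrt_log_lt_generalizationGap_le (hn : 0 < n) (hψ : LipschitzWith 1 ψ)
    (hX : StronglyMeasurable X) (hR : ∀ᵐ s ∂D, ‖X s‖ ≤ R) (hρ : 0 ≤ ρ) (hG : 0 < ρ * R) {δ : ℝ}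
    (hδ : 0 < δ) :
    (Measure.pi fun _ : Fin n => D).real {S | ∃ W, ‖W - V‖ ≤ ρ ∧
        ρ * R * √(8 * Real.log (2 / δ) / n) < generalizationGap D S (excessLoss ψ X V W)} ≤ δ := by
  rcases le_total 1 δ with h₁ | h₁
  · exact measureReal_le_one.trans h₁
  have hlog : 0 ≤ Real.log (2 / δ) := Real.log_nonneg (by rw [le_div_iff₀ hδ]; linarith)
  refine (measureReal_exists_lt_generalizationGap_excessLoss_le_of_ae hψ hX hR hρ hG
    (by positivity)).trans_eq ?_
  have hexponent : n * (ρ * R * √(8 * Real.log (2 / δ) / n)) ^ 2 / (8 * (ρ * R) ^ 2)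
      = Real.log (2 / δ) := by
    rw [mul_pow, Real.sq_sqrt (by positivity)]
    obtain ⟨hρ', hR'⟩ := mul_ne_zero_iff.1 hG.ne'
    field_simp
  rw [hexponent, Real.exp_neg, Real.exp_log (by positivity)]
  field_simp

end UniformDeviation

theorem exists_measurableSet_of_measureReal_le {Ω : Type*} [MeasurableSpace Ω] {P : Measure Ω}
    [IsProbabilityMeasure P] {Q : Ω → Prop} {δ : ℝ} (h : P.real {ω | ¬ Q ω} ≤ δ) :
    ∃ E, MeasurableSet E ∧ 1 - δ ≤ P.real E ∧ ∀ ω ∈ E, Q ω := by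
  refine ⟨(toMeasurable P {ω | ¬ Q ω})ᶜ, (measurableSet_toMeasurable _ _).compl, ?_, fun ω hω => ?_⟩
  · rw [probReal_compl_eq_one_sub (measurableSet_toMeasurable _ _), Measure.real,
      measure_toMeasurable]
    exact sub_le_sub_left h 1
  · by_contra hQ
    exact hω (subset_toMeasurable P _ hQ)

section VecNorm

variable {d : ℕ} {p q s : ℝ≥0∞}

theorem vecNorm_eq_toReal_eLpNorm (hp : p ≠ 0) (x : Fin d → ℝ) :
    vecNorm p x = (eLpNorm x p Measure.count).toReal := by
  rcases eq_or_ne p ∞ with rfl | hp_top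
  · simp only [vecNorm, PiLp.norm_eq_ciSup, eLpNorm_exponent_top, eLpNormEssSup_count,
      ENNReal.toReal_iSup fun _ => enorm_ne_top, toReal_enorm]
  · rw [vecNorm, PiLp.norm_eq_sum (ENNReal.toReal_pos hp hp_top),
      eLpNorm_eq_lintegral_rpow_enorm_toReal hp hp_top, lintegral_count, tsum_fintype,
      ← ENNReal.toReal_rpow, ENNReal.toReal_sum fun i _ => by finiteness]
    simp only [← ENNReal.toReal_rpow, toReal_enorm]

theorem eLpNorm_count_ne_top (p : ℝ≥0∞) (x : Fin d → ℝ) : eLpNorm x p Measure.count ≠ ∞ :=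
  (eLpNorm_count_lt_top_of_lt fun _ => enorm_lt_top).ne

theorem vecNorm_mono (hp : p ≠ 0) {x y : Fin d → ℝ} (h : ∀ i, |x i| ≤ |y i|) :
    vecNorm p x ≤ vecNorm p y := by
  rw [vecNorm_eq_toReal_eLpNorm hp, vecNorm_eq_toReal_eLpNorm hp]
  exact ENNReal.toReal_mono (eLpNorm_count_ne_top p y) (eLpNorm_mono h)

theorem vecNorm_one (x : Fin d → ℝ) : vecNorm 1 x = ∑ i, |x i| :=
  PiLp.norm_eq_of_L1 _

theorem abs_dotProduct_le_vecNorm_mul (hpq : p⁻¹ + q⁻¹ = 1) (v x : Fin d → ℝ) :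
    |v ⬝ᵥ x| ≤ vecNorm q v * vecNorm p x := by
  have hp : p ≠ 0 := by rintro rfl; simp at hpq
  have hq : q ≠ 0 := by rintro rfl; simp at hpq
  have : ENNReal.HolderTriple q p 1 := ⟨by rw [add_comm, hpq, inv_one]⟩
  calc |v ⬝ᵥ x| ≤ ∑ i, |(v • x) i| := Finset.abs_sum_le_sum_abs _ _
    _ = (eLpNorm (v • x) 1 Measure.count).toReal := by
        rw [← vecNorm_one, vecNorm_eq_toReal_eLpNorm one_ne_zero]
    _ ≤ (eLpNorm v q Measure.count * eLpNorm x p Measure.count).toReal :=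
        ENNReal.toReal_mono (ENNReal.mul_ne_top (eLpNorm_count_ne_top q v)
          (eLpNorm_count_ne_top p x))
          (eLpNorm_smul_le_mul_eLpNorm .of_discrete .of_discrete)
    _ = vecNorm q v * vecNorm p x := by
        rw [ENNReal.toReal_mul, vecNorm_eq_toReal_eLpNorm hp, vecNorm_eq_toReal_eLpNorm hq]

theorem exists_sum_abs_mul_eq_vecNorm (hpq : p⁻¹ + q⁻¹ = 1) (w : Fin d → ℝ) :
    ∃ g : Fin d → ℝ, vecNorm p g ≤ 1 ∧ ∑ i, |w i| * g i = vecNorm q w := by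
  rcases eq_or_ne p ∞ with rfl | hp
  · obtain rfl : q = 1 := by simpa using hpq
    refine ⟨1, ?_, by simp [vecNorm_one]⟩
    rw [vecNorm, PiLp.norm_eq_ciSup]
    exact Real.iSup_le (fun i => by simp) zero_le_one
  rcases eq_or_ne q ∞ with rfl | hq
  · obtain rfl : p = 1 := by simpa using hpq
    rcases isEmpty_or_nonempty (Fin d) with hd | hd
    · exact ⟨0, by simp [vecNorm_one], by simp [vecNorm, PiLp.norm_eq_ciSup]⟩
    obtain ⟨i, hi⟩ := Finite.exists_max fun i => |w i|
    refine ⟨Pi.single i 1, by simp [vecNorm_one, Pi.single_apply, apply_ite abs], ?_⟩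
    rw [vecNorm, PiLp.norm_eq_ciSup]
    simpa [Pi.single_apply] using
      le_antisymm (le_ciSup (f := fun j => |w j|) (Set.finite_range _).bddAbove i) (ciSup_le hi)
  have hconj : q.toReal.HolderConjugate p.toReal :=
    have : q.HolderConjugate p := ⟨by rw [add_comm, hpq, inv_one]⟩
    ENNReal.HolderConjugate.toReal_of_ne_top hq hp
  obtain ⟨g, hg, heq⟩ := (NNReal.isGreatest_Lp Finset.univ (fun i => ‖w i‖₊) hconj).1
  refine ⟨fun i => g i, ?_, ?_⟩
  · rw [vecNorm, PiLp.norm_eq_sum hconj.symm.pos]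
    refine Real.rpow_le_one (by positivity) ?_ (by positivity)
    simpa using mod_cast hg
  · rw [vecNorm, PiLp.norm_eq_sum hconj.pos]
    simpa using congrArg NNReal.toReal heq

theorem exists_dotProduct_eq_vecNorm (hpq : p⁻¹ + q⁻¹ = 1) (w : Fin d → ℝ) :
    ∃ x : Fin d → ℝ, vecNorm p x ≤ 1 ∧ w ⬝ᵥ x = vecNorm q w := by
  have hp : p ≠ 0 := by rintro rfl; simp at hpq
  obtain ⟨g, hg, heq⟩ := exists_sum_abs_mul_eq_vecNorm hpq w
  refine ⟨fun i => SignType.sign (w i) * g i, (vecNorm_mono hp ?_).trans hg, ?_⟩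
  · intro i
    rw [abs_mul]
    refine mul_le_of_le_one_left (abs_nonneg _) ?_
    rcases SignType.sign (w i) with _ | _ | _ <;> simp
  · rw [← heq, dotProduct]
    exact Finset.sum_congr rfl fun i _ => by rw [← mul_assoc, self_mul_sign]

theorem vecNorm_le_rpow_mul_vecNorm_of_le (hs : s ≠ 0) (hsp : s ≤ p) (x : Fin d → ℝ) :
    vecNorm s x ≤ (d : ℝ) ^ ((s⁻¹).toReal - (p⁻¹).toReal) * vecNorm p x := by
  have hp : p ≠ 0 := (pos_of_ne_zero hs |>.trans_le hsp).ne'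
  have hexp : 0 ≤ 1 / s.toReal - 1 / p.toReal := by
    simp only [one_div, ← ENNReal.toReal_inv, sub_nonneg]
    exact ENNReal.toReal_mono (ENNReal.inv_ne_top.2 hs) (ENNReal.inv_le_inv.2 hsp)
  have h := ENNReal.toReal_mono (by finiteness [eLpNorm_count_ne_top p x])
    (eLpNorm_le_eLpNorm_mul_rpow_measure_univ hsp
    (μ := Measure.count) (f := x) .of_discrete)
  rw [ENNReal.toReal_mul, ← ENNReal.toReal_rpow, ← vecNorm_eq_toReal_eLpNorm hp,
    ← vecNorm_eq_toReal_eLpNorm hs, Measure.count_univ, mul_comm] at h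
  simpa [ENNReal.toReal_inv] using h

theorem ne_zero_of_fact_one_le (p : ℝ≥0∞) [h : Fact (1 ≤ p)] : p ≠ 0 :=
  (zero_lt_one.trans_le h.out).ne'

variable [Fact (1 ≤ p)]

theorem vecNorm_nonneg (x : Fin d → ℝ) : 0 ≤ vecNorm p x :=
  norm_nonneg (WithLp.toLp p x : PiLp p (fun _ : Fin d => ℝ))

theorem vecNorm_add_le (x y : Fin d → ℝ) : vecNorm p (x + y) ≤ vecNorm p x + vecNorm p y :=
  norm_add_le (WithLp.toLp p x : PiLp p (fun _ : Fin d => ℝ)) (WithLp.toLp p y)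

theorem vecNorm_neg (x : Fin d → ℝ) : vecNorm p (-x) = vecNorm p x :=
  norm_neg (WithLp.toLp p x : PiLp p (fun _ : Fin d => ℝ))

theorem abs_vecNorm_sub_vecNorm_le (x y : Fin d → ℝ) :
    |vecNorm p x - vecNorm p y| ≤ vecNorm p (x - y) :=
  abs_norm_sub_norm_le (WithLp.toLp p x : PiLp p (fun _ : Fin d => ℝ)) (WithLp.toLp p y)

theorem vecNorm_smul (c : ℝ) (x : Fin d → ℝ) : vecNorm p (c • x) = |c| * vecNorm p x :=
  norm_smul c (WithLp.toLp p x : PiLp p (fun _ : Fin d => ℝ))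

theorem abs_apply_le_vecNorm (x : Fin d → ℝ) (i : Fin d) : |x i| ≤ vecNorm p x :=
  PiLp.norm_apply_le (WithLp.toLp p x : PiLp p (fun _ : Fin d => ℝ)) i

theorem vecNorm_rpow_eq_sum (hp : p ≠ ∞) (x : Fin d → ℝ) :
    vecNorm p x ^ p.toReal = ∑ i, |x i| ^ p.toReal := by
  have hp_pos : 0 < p.toReal := ENNReal.toReal_pos (ne_zero_of_fact_one_le p) hp
  rw [vecNorm, PiLp.norm_eq_sum hp_pos, one_div, Real.rpow_inv_rpow (by positivity) hp_pos.ne']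
  simp only [Real.norm_eq_abs]

theorem vecNorm_anti (hps : p ≤ s) (x : Fin d → ℝ) : vecNorm s x ≤ vecNorm p x := by
  have hN : 0 ≤ vecNorm p x := vecNorm_nonneg x
  rcases eq_or_ne s ∞ with rfl | hs
  · rw [vecNorm, PiLp.norm_eq_ciSup]
    exact Real.iSup_le (fun i => abs_apply_le_vecNorm x i) hN
  have : Fact (1 ≤ s) := ⟨(Fact.out : 1 ≤ p).trans hps⟩
  have hp : p ≠ ∞ := ne_top_of_le_ne_top hs hps
  have hps' : p.toReal ≤ s.toReal := ENNReal.toReal_mono hs hps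
  have hsplit : ∀ t : ℝ, 0 ≤ t → t ^ s.toReal = t ^ p.toReal * t ^ (s.toReal - p.toReal) :=
    fun t ht => by
      rw [← Real.rpow_add_of_nonneg ht ENNReal.toReal_nonneg (sub_nonneg.2 hps'), add_sub_cancel]
  refine (Real.rpow_le_rpow_iff (vecNorm_nonneg x) hN
    (ENNReal.toReal_pos (ne_zero_of_fact_one_le s) hs)).1 ?_
  calc vecNorm s x ^ s.toReal = ∑ i, |x i| ^ p.toReal * |x i| ^ (s.toReal - p.toReal) := by
        rw [vecNorm_rpow_eq_sum hs]
        exact Finset.sum_congr rfl fun i _ => hsplit _ (abs_nonneg _)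
    _ ≤ ∑ i, |x i| ^ p.toReal * vecNorm p x ^ (s.toReal - p.toReal) := by
        gcongr with i
        exact abs_apply_le_vecNorm x i
    _ = vecNorm p x ^ s.toReal := by rw [← Finset.sum_mul, ← vecNorm_rpow_eq_sum hp, hsplit _ hN]

theorem vecNorm_le_rpow_max_mul_vecNorm [Fact (1 ≤ s)] (x : Fin d → ℝ) :
    vecNorm s x ≤ (d : ℝ) ^ max 0 ((s⁻¹).toReal - (p⁻¹).toReal) * vecNorm p x := by
  have hmono : ∀ {a b : ℝ≥0∞} [Fact (1 ≤ a)], a ≤ b → (b⁻¹).toReal ≤ (a⁻¹).toReal :=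
    fun {a b} _ hab => ENNReal.toReal_mono (ENNReal.inv_ne_top.2 (ne_zero_of_fact_one_le a))
      (ENNReal.inv_le_inv.2 hab)
  rcases le_total p s with hps | hsp
  · rw [max_eq_left (sub_nonpos.2 (hmono hps)), Real.rpow_zero, one_mul]
    exact vecNorm_anti hps x
  · rw [max_eq_right (sub_nonneg.2 (hmono hsp))]
    exact vecNorm_le_rpow_mul_vecNorm_of_le (ne_zero_of_fact_one_le s) hsp x

end VecNorm

section EuclideanFactor

/-- The constant `d ^ max(0, 1/2 - 1/p)` of the inequality `‖x‖₂ ≤ C ‖x‖_p` on `ℝ^d`; it is `1` for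
`p ≤ 2`. -/
noncomputable def euclideanFactor (d : ℕ) (p : ℝ≥0∞) : ℝ :=
  (d : ℝ) ^ max 0 (1 / 2 - (p⁻¹).toReal)

variable {d : ℕ} {p q : ℝ≥0∞}

theorem one_le_of_inv_add_inv_eq_one (hpq : p⁻¹ + q⁻¹ = 1) : 1 ≤ p :=
  ENNReal.inv_le_one.1 (hpq ▸ le_self_add)

theorem toReal_inv_add_toReal_inv (hpq : p⁻¹ + q⁻¹ = 1) : (p⁻¹).toReal + (q⁻¹).toReal = 1 := by
  have hne : p⁻¹ + q⁻¹ ≠ ∞ := hpq ▸ ENNReal.one_ne_top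
  rw [← ENNReal.toReal_add (ENNReal.add_ne_top.1 hne).1 (ENNReal.add_ne_top.1 hne).2, hpq,
    ENNReal.toReal_one]

theorem euclideanFactor_nonneg (d : ℕ) (p : ℝ≥0∞) : 0 ≤ euclideanFactor d p :=
  Real.rpow_nonneg d.cast_nonneg _

theorem vecNorm_two_le_euclideanFactor_mul [Fact (1 ≤ p)] (x : Fin d → ℝ) :
    vecNorm 2 x ≤ euclideanFactor d p * vecNorm p x := by
  simpa [euclideanFactor] using vecNorm_le_rpow_max_mul_vecNorm (p := p) (s := 2) x

theorem vecNorm_le_euclideanFactor_mul_vecNorm_two [Fact (1 ≤ q)] (hpq : p⁻¹ + q⁻¹ = 1)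
    (x : Fin d → ℝ) :
    vecNorm q x ≤ euclideanFactor d p * vecNorm 2 x := by
  have hexp : (q⁻¹).toReal - ((2 : ℝ≥0∞)⁻¹).toReal = 1 / 2 - (p⁻¹).toReal := by
    rw [ENNReal.toReal_inv 2, ENNReal.toReal_ofNat]
    linarith [toReal_inv_add_toReal_inv hpq]
  simpa only [euclideanFactor, hexp] using vecNorm_le_rpow_max_mul_vecNorm (p := 2) (s := q) x

theorem one_le_euclideanFactor (hd : 0 < d) : 1 ≤ euclideanFactor d p :=
  Real.one_le_rpow (Nat.one_le_cast.2 hd) (le_max_left _ _)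

theorem euclideanFactor_mul_euclideanFactor (hd : 0 < d) (hpq : p⁻¹ + q⁻¹ = 1) :
    euclideanFactor d p * euclideanFactor d q = (d : ℝ) ^ |(q⁻¹).toReal - 1 / 2| := by
  have hdual : 1 / 2 - (p⁻¹).toReal = (q⁻¹).toReal - 1 / 2 := by
    linarith [toReal_inv_add_toReal_inv hpq]
  rw [euclideanFactor, euclideanFactor, ← Real.rpow_add (Nat.cast_pos.2 hd), hdual,
    ← neg_sub (q⁻¹).toReal, max_comm, max_comm 0, max_zero_add_max_neg_zero_eq_abs_self]

theorem euclideanFactor_mul_vecNorm_two_le [Fact (1 ≤ q)] (hd : 0 < d) (hpq : p⁻¹ + q⁻¹ = 1)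
    (x : Fin d → ℝ) :
    euclideanFactor d p * vecNorm 2 x ≤ (d : ℝ) ^ |(q⁻¹).toReal - 1 / 2| * vecNorm q x := by
  rw [← euclideanFactor_mul_euclideanFactor hd hpq, mul_assoc]
  exact mul_le_mul_of_nonneg_left (vecNorm_two_le_euclideanFactor_mul x)
    (euclideanFactor_nonneg d p)

theorem rpow_abs_two_mul_sub_one (d : ℕ) (a : ℝ) :
    (d : ℝ) ^ |2 * a - 1| = ((d : ℝ) ^ |a - 1 / 2|) ^ 2 := by
  rw [← Real.rpow_mul_natCast d.cast_nonneg, show 2 * a - 1 = (a - 1 / 2) * 2 by ring, abs_mul,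
    abs_two, Nat.cast_ofNat]

theorem euclideanFactor_sq_le [Fact (1 ≤ p)] (hd : 0 < d) :
    euclideanFactor d p ^ 2 ≤ if p ≤ 2 then 1 else (d : ℝ) := by
  split_ifs with hp
  · have hinv : ((2 : ℝ≥0∞)⁻¹).toReal ≤ (p⁻¹).toReal :=
      ENNReal.toReal_mono (ENNReal.inv_ne_top.2 (ne_zero_of_fact_one_le p))
        (ENNReal.inv_le_inv.2 hp)
    rw [ENNReal.toReal_inv, ENNReal.toReal_ofNat, ← one_div] at hinv
    rw [euclideanFactor, max_eq_left (sub_nonpos.2 hinv), Real.rpow_zero, one_pow]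
  · rw [euclideanFactor, ← Real.rpow_mul_natCast d.cast_nonneg]
    refine (Real.rpow_le_rpow_of_exponent_le (Nat.one_le_cast.2 hd) ?_).trans_eq (Real.rpow_one _)
    have : max 0 (1 / 2 - (p⁻¹).toReal) ≤ 1 / 2 :=
      max_le one_half_pos.le (sub_le_self _ ENNReal.toReal_nonneg)
    push_cast
    linarith

end EuclideanFactor

section RobustMargin

/-- The margin of the halfspace `w` at a labelled example `s = (x, y)` under the worst perturbation
of `x` in the `ℓ_p` ball of radius `r`, where `q` is conjugate to `p`. -/
noncomputable def robustMargin {d : ℕ} (q : ℝ≥0∞) (r : ℝ) (w : Fin d → ℝ)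
    (s : (Fin d → ℝ) × ℝ) : ℝ :=
  s.2 * (w ⬝ᵥ s.1) - r * vecNorm q w

/-- The labelled example `s = (x, y)` lies in the `ℓ_p` unit ball and has label `±1`. -/
def IsUnitExample {d : ℕ} (p : ℝ≥0∞) (s : (Fin d → ℝ) × ℝ) : Prop :=
  vecNorm p s.1 ≤ 1 ∧ |s.2| = 1

variable {d : ℕ} {p q : ℝ≥0∞} {r : ℝ} {s : (Fin d → ℝ) × ℝ}

theorem robustMargin_le_mul_dotProduct_add [Fact (1 ≤ q)] (hpq : p⁻¹ + q⁻¹ = 1) (hs : |s.2| ≤ 1)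
    (w : Fin d → ℝ) {u : Fin d → ℝ} (hu : vecNorm p u ≤ r) :
    robustMargin q r w s ≤ s.2 * (w ⬝ᵥ (s.1 + u)) := by
  have hperturb : |s.2 * (w ⬝ᵥ u)| ≤ r * vecNorm q w := by
    calc |s.2 * (w ⬝ᵥ u)| ≤ |w ⬝ᵥ u| := by
          rw [abs_mul]; exact mul_le_of_le_one_left (abs_nonneg _) hs
      _ ≤ vecNorm q w * vecNorm p u := abs_dotProduct_le_vecNorm_mul hpq w u
      _ ≤ vecNorm q w * r := mul_le_mul_of_nonneg_left hu (vecNorm_nonneg w)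
      _ = r * vecNorm q w := mul_comm _ _
  rw [robustMargin, dotProduct_add, mul_add]
  linarith [(abs_le.1 hperturb).1]

theorem exists_mul_dotProduct_add_eq_robustMargin [Fact (1 ≤ p)] (hpq : p⁻¹ + q⁻¹ = 1) (hr : 0 ≤ r)
    (hs : |s.2| = 1) (w : Fin d → ℝ) :
    ∃ u, vecNorm p u ≤ r ∧ s.2 * (w ⬝ᵥ (s.1 + u)) = robustMargin q r w s := by
  obtain ⟨x, hx, hwx⟩ := exists_dotProduct_eq_vecNorm hpq w
  refine ⟨(-(s.2 * r)) • x, ?_, ?_⟩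
  · rw [vecNorm_smul, abs_neg, abs_mul, hs, one_mul, abs_of_nonneg hr]
    exact mul_le_of_le_one_right hr hx
  · have hsq : s.2 * s.2 = 1 := by rw [← abs_mul_abs_self, hs, one_mul]
    rw [robustMargin, dotProduct_add, dotProduct_smul, hwx, smul_eq_mul]
    linear_combination (-r * vecNorm q w) * hsq

theorem robustMargin_smul [Fact (1 ≤ q)] {c : ℝ} (hc : 0 ≤ c) (w : Fin d → ℝ) :
    robustMargin q r (c • w) s = c * robustMargin q r w s := by
  rw [robustMargin, robustMargin, smul_dotProduct, vecNorm_smul, abs_of_nonneg hc, smul_eq_mul]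
  ring

theorem abs_dotProduct_le_vecNorm [Fact (1 ≤ q)] (hpq : p⁻¹ + q⁻¹ = 1) {x : Fin d → ℝ}
    (hx : vecNorm p x ≤ 1) (w : Fin d → ℝ) : |w ⬝ᵥ x| ≤ vecNorm q w :=
  (abs_dotProduct_le_vecNorm_mul hpq w x).trans (mul_le_of_le_one_right (vecNorm_nonneg w) hx)

theorem IsUnitExample.abs_robustMargin_le [Fact (1 ≤ q)] (hpq : p⁻¹ + q⁻¹ = 1) (hr : 0 ≤ r)
    (hs : IsUnitExample p s) (w : Fin d → ℝ) :
    |robustMargin q r w s| ≤ (1 + r) * vecNorm q w := by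
  calc |robustMargin q r w s| ≤ |s.2 * (w ⬝ᵥ s.1)| + |r * vecNorm q w| := abs_sub _ _
    _ = |w ⬝ᵥ s.1| + r * vecNorm q w := by
        rw [abs_mul, hs.2, one_mul, abs_of_nonneg (mul_nonneg hr (vecNorm_nonneg w))]
    _ ≤ vecNorm q w + r * vecNorm q w :=
        add_le_add_left (abs_dotProduct_le_vecNorm hpq hs.1 w) _
    _ = (1 + r) * vecNorm q w := by ring

theorem measurable_robustMargin (q : ℝ≥0∞) (r : ℝ) (w : Fin d → ℝ) :
    Measurable (robustMargin q r w) := by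
  unfold robustMargin dotProduct
  fun_prop

end RobustMargin

section Lift

variable {d : ℕ} {p q : ℝ≥0∞} {r : ℝ} {s : (Fin d → ℝ) × ℝ}

/-- The feature vector `(y x, √r C)` of the example `(x, y)`, with `C = euclideanFactor d p`. Paired
with `liftedWeight p q r w` it gives the robust margin, and the scaling by `C` balances the norms of
the two coordinates. -/
noncomputable def liftedFeature (p : ℝ≥0∞) (r : ℝ) (s : (Fin d → ℝ) × ℝ) :
    WithLp 2 (EuclideanSpace ℝ (Fin d) × ℝ) :=
  WithLp.toLp 2 (WithLp.toLp 2 (s.2 • s.1), √r * euclideanFactor d p)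

/-- The weight vector `(w, -√r ‖w‖_q / C)` with `C = euclideanFactor d p`; see `liftedFeature`. -/
noncomputable def liftedWeight (p q : ℝ≥0∞) (r : ℝ) (w : Fin d → ℝ) :
    WithLp 2 (EuclideanSpace ℝ (Fin d) × ℝ) :=
  WithLp.toLp 2 (WithLp.toLp 2 w, -(√r * vecNorm q w / euclideanFactor d p))

theorem inner_liftedWeight_liftedFeature (hd : 0 < d) (hr : 0 ≤ r) (w : Fin d → ℝ) :
    inner ℝ (liftedWeight p q r w) (liftedFeature p r s) = robustMargin q r w s := by
  have hC : euclideanFactor d p ≠ 0 := (zero_lt_one.trans_le (one_le_euclideanFactor hd)).ne'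
  rw [WithLp.prod_inner_apply]
  simp only [liftedWeight, liftedFeature, EuclideanSpace.inner_toLp_toLp, robustMargin]
  simp only [star_trivial, smul_dotProduct, smul_eq_mul, dotProduct_comm s.1, RCLike.inner_apply,
    conj_trivial]
  field_simp
  rw [Real.sq_sqrt hr]
  ring

theorem stronglyMeasurable_liftedFeature (p : ℝ≥0∞) (r : ℝ) :
    StronglyMeasurable (liftedFeature (d := d) p r) := by
  refine Continuous.stronglyMeasurable ?_
  unfold liftedFeature
  fun_prop

theorem IsUnitExample.norm_liftedFeature_le [Fact (1 ≤ p)] (hr : 0 ≤ r)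
    (hs : IsUnitExample p s) : ‖liftedFeature p r s‖ ≤ euclideanFactor d p * √(1 + r) := by
  have hC : 0 ≤ euclideanFactor d p := euclideanFactor_nonneg d p
  have hx : vecNorm 2 (s.2 • s.1) ≤ euclideanFactor d p := by
    rw [vecNorm_smul, hs.2, one_mul]
    exact (vecNorm_two_le_euclideanFactor_mul s.1).trans (mul_le_of_le_one_right hC hs.1)
  refine le_of_sq_le_sq ?_ (by positivity)
  calc ‖liftedFeature p r s‖ ^ 2 = vecNorm 2 (s.2 • s.1) ^ 2 + (√r * euclideanFactor d p) ^ 2 := by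
        rw [WithLp.prod_norm_sq_eq_of_L2, Real.norm_eq_abs, sq_abs]; rfl
    _ ≤ euclideanFactor d p ^ 2 + (√r * euclideanFactor d p) ^ 2 := by
        gcongr; exact vecNorm_nonneg _
    _ = (euclideanFactor d p * √(1 + r)) ^ 2 := by
        rw [mul_pow, mul_pow, Real.sq_sqrt hr, Real.sq_sqrt (by linarith)]; ring

theorem norm_liftedWeight_sub_le [Fact (1 ≤ q)] (hd : 0 < d) (hpq : p⁻¹ + q⁻¹ = 1) (hr : 0 ≤ r)
    (w v : Fin d → ℝ) :
    ‖liftedWeight p q r w - liftedWeight p q r v‖ ≤ √(1 + r) * vecNorm 2 (w - v) := by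
  have hC : 0 < euclideanFactor d p := zero_lt_one.trans_le (one_le_euclideanFactor hd)
  have hN : 0 ≤ vecNorm 2 (w - v) := vecNorm_nonneg _
  have hq : |(vecNorm q v - vecNorm q w) / euclideanFactor d p| ≤ vecNorm 2 (w - v) := by
    rw [abs_div, abs_of_pos hC, div_le_iff₀' hC, abs_sub_comm]
    exact (abs_vecNorm_sub_vecNorm_le w v).trans (vecNorm_le_euclideanFactor_mul_vecNorm_two hpq _)
  refine le_of_sq_le_sq ?_ (by positivity)
  calc ‖liftedWeight p q r w - liftedWeight p q r v‖ ^ 2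
      = vecNorm 2 (w - v) ^ 2 + (-(√r * vecNorm q w / euclideanFactor d p)
          - -(√r * vecNorm q v / euclideanFactor d p)) ^ 2 := by
        rw [WithLp.prod_norm_sq_eq_of_L2, ← sq_abs (_ - _)]; rfl
    _ = vecNorm 2 (w - v) ^ 2
          + √r ^ 2 * |(vecNorm q v - vecNorm q w) / euclideanFactor d p| ^ 2 := by
        rw [sq_abs]; ring
    _ ≤ vecNorm 2 (w - v) ^ 2 + √r ^ 2 * vecNorm 2 (w - v) ^ 2 := by gcongr
    _ = (√(1 + r) * vecNorm 2 (w - v)) ^ 2 := by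
        rw [mul_pow, Real.sq_sqrt hr, Real.sq_sqrt (by linarith)]; ring

theorem IsUnitExample.abs_robustMargin_sub_le [Fact (1 ≤ p)] [Fact (1 ≤ q)] (hd : 0 < d)
    (hpq : p⁻¹ + q⁻¹ = 1) (hr : 0 ≤ r) (hs : IsUnitExample p s) (w v : Fin d → ℝ) :
    |robustMargin q r w s - robustMargin q r v s|
      ≤ euclideanFactor d p * (1 + r) * vecNorm 2 (w - v) := by
  rw [← inner_liftedWeight_liftedFeature (p := p) hd hr,
    ← inner_liftedWeight_liftedFeature (p := p) hd hr, ← inner_sub_left]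
  calc _ ≤ ‖liftedWeight p q r w - liftedWeight p q r v‖ * ‖liftedFeature p r s‖ :=
        abs_real_inner_le_norm _ _
    _ ≤ (√(1 + r) * vecNorm 2 (w - v)) * (euclideanFactor d p * √(1 + r)) :=
        mul_le_mul (norm_liftedWeight_sub_le hd hpq hr w v) (hs.norm_liftedFeature_le hr)
          (norm_nonneg _) (mul_nonneg (Real.sqrt_nonneg _) (vecNorm_nonneg _))
    _ = euclideanFactor d p * (1 + r) * vecNorm 2 (w - v) := by
        linear_combination euclideanFactor d p * vecNorm 2 (w - v)
          * Real.mul_self_sqrt (by linarith : 0 ≤ 1 + r)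

end Lift

section Descent

theorem exists_le_and_le_of_sq_le_sub {D e : ℕ → ℝ} {N : ℕ} {η ε L : ℝ} (hη : 0 < η) (hε : 0 ≤ ε)
    (hD : ∀ k, 0 ≤ D k) (hstep : ∀ k < N, D (k + 1) ^ 2 ≤ D k ^ 2 - 2 * η * e k + (η * L) ^ 2)
    (he : e N ≤ L * D N) (hL : η * L ^ 2 ≤ ε) (hD₀ : D 0 ^ 2 ≤ η * ε * (N + 1)) :
    ∃ k ≤ N, e k ≤ ε ∧ D k ≤ D 0 := by
  have hdecay : ∀ k ≤ N, (∀ j < k, ε < e j) → D k ^ 2 ≤ D 0 ^ 2 - η * ε * k := by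
    intro k hk hlarge
    induction k with
    | zero => simp
    | succ k ih =>
      have hprev := ih (by omega) fun j hj => hlarge j (by omega)
      have hprogress : η * ε ≤ η * e k := mul_le_mul_of_nonneg_left (hlarge k (by omega)).le hη.le
      have hnoise : (η * L) ^ 2 ≤ η * ε := by
        rw [mul_pow, sq η, mul_assoc]
        exact mul_le_mul_of_nonneg_left hL hη.le
      push_cast
      linarith [hstep k (by omega)]
  have hexists : ∃ k, k ≤ N ∧ e k ≤ ε := by
    by_contra! hlarge
    have hDN : D N ^ 2 ≤ η * ε := by linarith [hdecay N le_rfl fun j hj => hlarge j hj.le]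
    have hεN : ε < L * D N := (hlarge N le_rfl).trans_le he
    have : ε ^ 2 < ε ^ 2 := calc
      ε ^ 2 < (L * D N) ^ 2 := pow_lt_pow_left₀ hεN hε two_ne_zero
      _ = L ^ 2 * D N ^ 2 := mul_pow _ _ _
      _ ≤ L ^ 2 * (η * ε) := mul_le_mul_of_nonneg_left hDN (sq_nonneg L)
      _ = η * L ^ 2 * ε := by ring
      _ ≤ ε * ε := mul_le_mul_of_nonneg_right hL hε
      _ = ε ^ 2 := (sq ε).symm
    exact lt_irrefl _ this
  classical
  obtain ⟨hkN, hk⟩ := Nat.find_spec hexists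
  refine ⟨Nat.find hexists, hkN, hk, le_of_sq_le_sq ?_ (hD 0)⟩
  refine (hdecay _ hkN fun j hj => ?_).trans (sub_le_self _ (by positivity))
  exact not_le.1 fun hej => Nat.find_min hexists hj ⟨hj.le.trans hkN, hej⟩

end Descent

section AdversarialTraining

/-- The empirical robust risk of the halfspace `w` on the sample `S`: the average of `ψ` at the
robust margins. -/
noncomputable def empiricalRobustRisk {d n : ℕ} (ψ : ℝ → ℝ) (q : ℝ≥0∞) (r : ℝ)
    (S : Fin n → (Fin d → ℝ) × ℝ) (w : Fin d → ℝ) : ℝ :=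
  (n : ℝ)⁻¹ * ∑ i, ψ (robustMargin q r w (S i))

/-- `G` is a direction of adversarial training at `w`: an average of subgradients of the losses at
maximizing perturbations, so that `w - η • G` is the next iterate for the step size `η`. -/
def IsAdvGradient {d n : ℕ} (ℓ : ℝ → ℝ) (p : ℝ≥0∞) (r : ℝ) (S : Fin n → (Fin d → ℝ) × ℝ)
    (w G : Fin d → ℝ) : Prop :=
  ∃ (δ : Fin n → Fin d → ℝ) (g : Fin n → ℝ),
    (∀ i, vecNorm p (δ i) ≤ r ∧ ∀ δ', vecNorm p δ' ≤ r →
      ℓ ((S i).2 * (w ⬝ᵥ ((S i).1 + δ'))) ≤ ℓ ((S i).2 * (w ⬝ᵥ ((S i).1 + δ i)))) ∧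
    (∀ i, IsSubgradient ℓ ((S i).2 * (w ⬝ᵥ ((S i).1 + δ i))) (g i)) ∧
    G = (n : ℝ)⁻¹ • ∑ i, (g i * (S i).2) • ((S i).1 + δ i)

theorem IsSubgradient.abs_le_one {ψ : ℝ → ℝ} (hψ : LipschitzWith 1 ψ) {a g : ℝ}
    (h : IsSubgradient ψ a g) : |g| ≤ 1 := by
  have hright := h (a + 1)
  have hleft := h (a - 1)
  have hright_lip := le_of_abs_le (abs_sub_le_of_lipschitzWith_one hψ (a + 1) a)
  have hleft_lip := le_of_abs_le (abs_sub_le_of_lipschitzWith_one hψ (a - 1) a)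
  norm_num at hright hleft hright_lip hleft_lip
  exact abs_le.2 ⟨by linarith, by linarith⟩

variable {d n : ℕ} {p q : ℝ≥0∞} {r : ℝ} {ℓ : ℝ → ℝ} {S : Fin n → (Fin d → ℝ) × ℝ}
  {w G : Fin d → ℝ}

theorem vecNorm_sum_le [Fact (1 ≤ p)] {ι : Type*} (s : Finset ι) (f : ι → Fin d → ℝ) :
    vecNorm p (∑ i ∈ s, f i) ≤ ∑ i ∈ s, vecNorm p (f i) := by
  have h := norm_sum_le s fun i => (WithLp.toLp p (f i) : PiLp p (fun _ : Fin d => ℝ))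
  rwa [← WithLp.toLp_sum] at h

theorem vecNorm_two_sq_eq_dotProduct (x : Fin d → ℝ) : vecNorm 2 x ^ 2 = x ⬝ᵥ x := by
  rw [vecNorm, PiLp.norm_sq_eq_of_L2, dotProduct]
  exact Finset.sum_congr rfl fun i _ => by rw [Real.norm_eq_abs, sq_abs, sq]

theorem vecNorm_two_sub_smul_sq (u G : Fin d → ℝ) (η : ℝ) :
    vecNorm 2 (u - η • G) ^ 2
      = vecNorm 2 u ^ 2 - 2 * η * (G ⬝ᵥ u) + (η * vecNorm 2 G) ^ 2 := by
  simp only [mul_pow, vecNorm_two_sq_eq_dotProduct, sub_dotProduct, dotProduct_sub,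
    smul_dotProduct, dotProduct_smul, smul_eq_mul, dotProduct_comm u G]
  ring

theorem IsAdvGradient.vecNorm_two_le [Fact (1 ≤ p)] (hn : 0 < n) (hℓ : LipschitzWith 1 ℓ)
    (hS : ∀ i, IsUnitExample p (S i)) (hG : IsAdvGradient ℓ p r S w G) :
    vecNorm 2 G ≤ euclideanFactor d p * (1 + r) := by
  obtain ⟨δ, g, hδ, hg, rfl⟩ := hG
  have hterm : ∀ i, vecNorm 2 ((g i * (S i).2) • ((S i).1 + δ i))
      ≤ euclideanFactor d p * (1 + r) := fun i => by
    have hcoef : |g i * (S i).2| ≤ 1 := by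
      rw [abs_mul, (hS i).2, mul_one]
      exact (hg i).abs_le_one hℓ
    calc vecNorm 2 ((g i * (S i).2) • ((S i).1 + δ i)) ≤ vecNorm 2 ((S i).1 + δ i) := by
          rw [vecNorm_smul]
          exact mul_le_of_le_one_left (vecNorm_nonneg _) hcoef
      _ ≤ euclideanFactor d p * vecNorm p ((S i).1 + δ i) := vecNorm_two_le_euclideanFactor_mul _
      _ ≤ euclideanFactor d p * (1 + r) :=
          mul_le_mul_of_nonneg_left ((vecNorm_add_le _ _).trans (add_le_add (hS i).1 (hδ i).1))
            (euclideanFactor_nonneg d p)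
  rw [vecNorm_smul, abs_of_nonneg (by positivity), inv_mul_le_iff₀ (Nat.cast_pos.2 hn)]
  calc _ ≤ ∑ i, vecNorm 2 ((g i * (S i).2) • ((S i).1 + δ i)) := vecNorm_sum_le _ _
    _ ≤ ∑ _i : Fin n, euclideanFactor d p * (1 + r) := Finset.sum_le_sum fun i _ => hterm i
    _ = n * (euclideanFactor d p * (1 + r)) := by simp

-- The maximizing perturbations realize the robust margin at `w`, while at `V` they only bound it.
theorem IsAdvGradient.empiricalRobustRisk_sub_le [Fact (1 ≤ p)] [Fact (1 ≤ q)]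
    (hpq : p⁻¹ + q⁻¹ = 1) (hr : 0 ≤ r) (hℓ : Antitone ℓ) (hS : ∀ i, |(S i).2| = 1)
    (hG : IsAdvGradient ℓ p r S w G) (V : Fin d → ℝ) :
    empiricalRobustRisk ℓ q r S w - empiricalRobustRisk ℓ q r S V ≤ G ⬝ᵥ (w - V) := by
  obtain ⟨δ, g, hδ, hg, rfl⟩ := hG
  rw [empiricalRobustRisk, empiricalRobustRisk, ← mul_sub, ← Finset.sum_sub_distrib,
    smul_dotProduct, sum_dotProduct, smul_eq_mul]
  refine mul_le_mul_of_nonneg_left (Finset.sum_le_sum fun i _ => ?_) (by positivity)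
  obtain ⟨u, hu, hu_eq⟩ := exists_mul_dotProduct_add_eq_robustMargin hpq hr (hS i) w
  have hmax := (hδ i).2 u hu
  have hsub := hg i ((S i).2 * (V ⬝ᵥ ((S i).1 + δ i)))
  have hV := hℓ (robustMargin_le_mul_dotProduct_add hpq (hS i).le V (hδ i).1)
  rw [hu_eq] at hmax
  rw [smul_dotProduct, dotProduct_sub, dotProduct_comm _ w, dotProduct_comm _ V, smul_eq_mul]
  linarith

theorem empiricalRobustRisk_sub_le [Fact (1 ≤ p)] [Fact (1 ≤ q)] (hd : 0 < d) (hn : 0 < n)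
    (hpq : p⁻¹ + q⁻¹ = 1) (hr : 0 ≤ r) (hℓ : LipschitzWith 1 ℓ)
    (hS : ∀ i, IsUnitExample p (S i)) (w V : Fin d → ℝ) :
    empiricalRobustRisk ℓ q r S w - empiricalRobustRisk ℓ q r S V
      ≤ euclideanFactor d p * (1 + r) * vecNorm 2 (w - V) := by
  rw [empiricalRobustRisk, empiricalRobustRisk, ← mul_sub, ← Finset.sum_sub_distrib,
    inv_mul_le_iff₀ (Nat.cast_pos.2 hn)]
  calc _ ≤ ∑ _i : Fin n, euclideanFactor d p * (1 + r) * vecNorm 2 (w - V) :=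
        Finset.sum_le_sum fun i _ => (le_of_abs_le (abs_sub_le_of_lipschitzWith_one hℓ _ _)).trans
          ((hS i).abs_robustMargin_sub_le hd hpq hr w V)
    _ = n * (euclideanFactor d p * (1 + r) * vecNorm 2 (w - V)) := by simp

theorem IsAdvTraining.exists_isAdvGradient {η : ℝ} {N : ℕ} {w : ℕ → Fin d → ℝ}
    (hw : IsAdvTraining ℓ p r η S N w) {k : ℕ} (hk : k < N) :
    ∃ G, IsAdvGradient ℓ p r S (w k) G ∧ w (k + 1) = w k - η • G := by
  obtain ⟨δ, g, hδ, hg, hstep⟩ := hw k hk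
  exact ⟨_, ⟨δ, g, hδ, hg, rfl⟩, by rw [hstep, smul_smul, div_eq_mul_inv]⟩

theorem IsAdvTraining.exists_empiricalRobustRisk_le [Fact (1 ≤ p)] [Fact (1 ≤ q)] (hd : 0 < d)
    (hn : 0 < n) (hpq : p⁻¹ + q⁻¹ = 1) (hr : 0 ≤ r) (hℓd : Antitone ℓ) (hℓL : LipschitzWith 1 ℓ)
    {η ε : ℝ} (hη : 0 < η) (hε : 0 ≤ ε) (hηε : η * (euclideanFactor d p * (1 + r)) ^ 2 ≤ ε)
    (hS : ∀ i, IsUnitExample p (S i)) {N : ℕ} {w : ℕ → Fin d → ℝ} (hw : IsAdvTraining ℓ p r η S N w)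
    {V : Fin d → ℝ} (hV : vecNorm 2 (w 0 - V) ^ 2 ≤ η * ε * (N + 1)) :
    ∃ k ≤ N, empiricalRobustRisk ℓ q r S (w k) - empiricalRobustRisk ℓ q r S V ≤ ε ∧
      vecNorm 2 (w k - V) ≤ vecNorm 2 (w 0 - V) := by
  refine exists_le_and_le_of_sq_le_sub (D := fun k => vecNorm 2 (w k - V)) hη hε
    (fun k => vecNorm_nonneg _) (fun k hk => ?_)
    (empiricalRobustRisk_sub_le hd hn hpq hr hℓL hS (w N) V) hηε hV
  obtain ⟨G, hG, hstep⟩ := hw.exists_isAdvGradient hk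
  have hdescent := mul_le_mul_of_nonneg_left
    (hG.empiricalRobustRisk_sub_le hpq hr hℓd (fun i => (hS i).2) V) (by positivity : 0 ≤ 2 * η)
  have hnorm : (η * vecNorm 2 G) ^ 2 ≤ (η * (euclideanFactor d p * (1 + r))) ^ 2 := by
    gcongr
    · exact mul_nonneg hη.le (vecNorm_nonneg _)
    · exact hG.vecNorm_two_le hn hℓL hS
  rw [hstep, sub_right_comm, vecNorm_two_sub_smul_sq]
  linarith

end AdversarialTraining

section RobustError

/-- The examples `(x, y)` for which some perturbation of `x` in the `ℓ_p` ball of radius `r` is not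
given the label `y` by the halfspace `w`; `robustErr` is the mass of this set. -/
def robustErrSet {d : ℕ} (p : ℝ≥0∞) (r : ℝ) (w : Fin d → ℝ) : Set ((Fin d → ℝ) × ℝ) :=
  {s | ∃ x' : Fin d → ℝ, vecNorm p (s.1 - x') ≤ r ∧ s.2 ≠ sgn (w ⬝ᵥ x')}

theorem sgn_mul_self_nonneg (t : ℝ) : 0 ≤ sgn t * t := by
  unfold sgn
  split_ifs with h <;> linarith

theorem mul_nonpos_of_ne_sgn {y t : ℝ} (hy : |y| = 1) (h : y ≠ sgn t) : y * t ≤ 0 := by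
  unfold sgn at h
  rcases eq_or_eq_neg_of_abs_eq hy with rfl | rfl <;> split_ifs at h with ht
  · exact absurd rfl h
  · linarith
  · linarith
  · exact absurd rfl h

variable {d : ℕ} {p q : ℝ≥0∞} {r γ c : ℝ} {ℓ : ℝ → ℝ} {s : (Fin d → ℝ) × ℝ} {v w : Fin d → ℝ}

theorem robustMargin_nonpos_of_mem_robustErrSet [Fact (1 ≤ p)] [Fact (1 ≤ q)]
    (hpq : p⁻¹ + q⁻¹ = 1) (hs : |s.2| = 1) (h : s ∈ robustErrSet p r w) :
    robustMargin q r w s ≤ 0 := by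
  obtain ⟨x', hx', hne⟩ := h
  have hu : vecNorm p (x' - s.1) ≤ r := by rwa [← neg_sub, vecNorm_neg]
  have hmargin := robustMargin_le_mul_dotProduct_add hpq hs.le w hu
  rw [add_sub_cancel] at hmargin
  exact hmargin.trans (mul_nonpos_of_ne_sgn hs hne)

theorem robustMargin_nonneg_of_notMem_robustErrSet [Fact (1 ≤ p)] (hpq : p⁻¹ + q⁻¹ = 1)
    (hr : 0 ≤ r) (hs : |s.2| = 1) (h : s ∉ robustErrSet p r w) : 0 ≤ robustMargin q r w s := by
  obtain ⟨u, hu, hmargin⟩ := exists_mul_dotProduct_add_eq_robustMargin hpq hr hs w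
  have hsgn : s.2 = sgn (w ⬝ᵥ (s.1 + u)) := by
    by_contra hne
    exact h ⟨s.1 + u, by rwa [sub_add_cancel_left, vecNorm_neg], hne⟩
  rw [← hmargin, hsgn]
  exact sgn_mul_self_nonneg _

theorem le_robustMargin_of_lt_abs_dotProduct [Fact (1 ≤ q)] (hr : 0 ≤ r) (hv : vecNorm q v ≤ 1)
    (hs : |s.2| = 1) (hm : 0 ≤ robustMargin q r v s) (h : r + γ < |v ⬝ᵥ s.1|) :
    γ ≤ robustMargin q r v s := by
  have hpenalty : r * vecNorm q v ≤ r := mul_le_of_le_one_right hr hv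
  have hnonneg : 0 ≤ s.2 * (v ⬝ᵥ s.1) := by
    have := mul_nonneg hr (vecNorm_nonneg (p := q) v)
    rw [robustMargin] at hm
    linarith
  have habs : |v ⬝ᵥ s.1| = s.2 * (v ⬝ᵥ s.1) := by rw [← abs_of_nonneg hnonneg, abs_mul, hs, one_mul]
  rw [robustMargin]
  linarith

theorem IsUnitExample.loss_robustMargin_smul_le [Fact (1 ≤ q)] (hpq : p⁻¹ + q⁻¹ = 1) (hr : 0 ≤ r)
    (hs : IsUnitExample p s) (hℓ : LipschitzWith 1 ℓ) (hv : vecNorm q v ≤ 1) (hc : 0 ≤ c) :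
    ℓ (robustMargin q r (c • v) s) ≤ ℓ 0 + (1 + r) * c := by
  have hmargin : |robustMargin q r (c • v) s| ≤ (1 + r) * c := by
    refine (hs.abs_robustMargin_le hpq hr _).trans (mul_le_mul_of_nonneg_left ?_ (by positivity))
    rw [vecNorm_smul, abs_of_nonneg hc]
    exact mul_le_of_le_one_right hc hv
  have hlip := abs_sub_le_of_lipschitzWith_one hℓ (robustMargin q r (c • v) s) 0
  rw [sub_zero] at hlip
  linarith [le_of_abs_le hlip]

theorem IsUnitExample.loss_robustMargin_smul_le_indicator [Fact (1 ≤ p)] [Fact (1 ≤ q)]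
    (hpq : p⁻¹ + q⁻¹ = 1) (hr : 0 ≤ r) (hs : IsUnitExample p s) (hℓ₀ : ∀ t, 0 ≤ ℓ t)
    (hℓd : Antitone ℓ) (hℓL : LipschitzWith 1 ℓ) (hv : vecNorm q v ≤ 1) (hc : 0 ≤ c)
    {A : Set ((Fin d → ℝ) × ℝ)} (hA : robustErrSet p r v ⊆ A) :
    ℓ (robustMargin q r (c • v) s)
      ≤ A.indicator (fun _ => ℓ 0 + (1 + r) * c) s
        + {s | |v ⬝ᵥ s.1| ≤ r + γ}.indicator (fun _ => ℓ 0) s + ℓ (c * γ) := by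
  set F := {s : (Fin d → ℝ) × ℝ | |v ⬝ᵥ s.1| ≤ r + γ}
  have hF₀ : 0 ≤ F.indicator (fun _ => ℓ 0) s := Set.indicator_nonneg (fun _ _ => hℓ₀ 0) s
  have hγ₀ := hℓ₀ (c * γ)
  by_cases hsA : s ∈ A
  · rw [Set.indicator_of_mem hsA]
    linarith [hs.loss_robustMargin_smul_le hpq hr hℓL hv hc]
  have hm := robustMargin_nonneg_of_notMem_robustErrSet hpq hr hs.2 fun h => hsA (hA h)
  rw [Set.indicator_of_notMem hsA, robustMargin_smul hc]
  by_cases hsF : s ∈ F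
  · rw [Set.indicator_of_mem hsF]
    linarith [hℓd (mul_nonneg hc hm)]
  · have hγm := le_robustMargin_of_lt_abs_dotProduct hr hv hs.2 hm (not_le.1 hsF)
    linarith [hℓd (mul_le_mul_of_nonneg_left hγm hc)]

variable {D : Measure ((Fin d → ℝ) × ℝ)} [IsFiniteMeasure D]

theorem integrable_comp_robustMargin [Fact (1 ≤ q)] (hpq : p⁻¹ + q⁻¹ = 1) (hr : 0 ≤ r)
    (hD : ∀ᵐ s ∂D, IsUnitExample p s) (hℓ : LipschitzWith 1 ℓ) (w : Fin d → ℝ) :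
    Integrable (fun s => ℓ (robustMargin q r w s)) D := by
  refine Integrable.of_bound (C := |ℓ 0| + (1 + r) * vecNorm q w)
    (hℓ.continuous.measurable.comp (measurable_robustMargin q r w)).aestronglyMeasurable ?_
  filter_upwards [hD] with s hs
  have hlip := abs_sub_le_of_lipschitzWith_one hℓ (robustMargin q r w s) 0
  rw [sub_zero] at hlip
  have htriangle := abs_sub_abs_le_abs_sub (ℓ (robustMargin q r w s)) (ℓ 0)
  rw [Real.norm_eq_abs]
  linarith [hs.abs_robustMargin_le hpq hr w]

theorem mul_robustErr_le_integral [Fact (1 ≤ p)] [Fact (1 ≤ q)] (hpq : p⁻¹ + q⁻¹ = 1)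
    (hr : 0 ≤ r) (hD : ∀ᵐ s ∂D, IsUnitExample p s) (hℓ₀ : ∀ t, 0 ≤ ℓ t) (hℓd : Antitone ℓ)
    (hℓL : LipschitzWith 1 ℓ) (w : Fin d → ℝ) :
    ℓ 0 * robustErr D p r w ≤ ∫ s, ℓ (robustMargin q r w s) ∂D := by
  refine le_trans (mul_le_mul_of_nonneg_left ?_ (hℓ₀ 0)) (mul_meas_ge_le_integral_of_nonneg
    (Filter.Eventually.of_forall fun s => hℓ₀ _) (integrable_comp_robustMargin hpq hr hD hℓL w)
    (ℓ 0))
  refine ENNReal.toReal_mono (measure_ne_top _ _) (measure_mono_ae ?_)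
  filter_upwards [hD] with s hs hsw
  exact hℓd (robustMargin_nonpos_of_mem_robustErrSet hpq hs.2 hsw)

end RobustError

section Comparator

variable {d : ℕ} {p q : ℝ≥0∞} {r γ c : ℝ} {ℓ : ℝ → ℝ} {v : Fin d → ℝ}
  {D : Measure ((Fin d → ℝ) × ℝ)} [IsProbabilityMeasure D]

theorem integral_loss_robustMargin_smul_le [Fact (1 ≤ p)] [Fact (1 ≤ q)] (hpq : p⁻¹ + q⁻¹ = 1)
    (hr : 0 ≤ r) (hD : ∀ᵐ s ∂D, IsUnitExample p s) (hℓ₀ : ∀ t, 0 ≤ ℓ t) (hℓd : Antitone ℓ)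
    (hℓL : LipschitzWith 1 ℓ) (hv : vecNorm q v ≤ 1) (hc : 0 ≤ c) :
    ∫ s, ℓ (robustMargin q r (c • v) s) ∂D
      ≤ (ℓ 0 + (1 + r) * c) * robustErr D p r v + ℓ 0 * D.real {s | |v ⬝ᵥ s.1| ≤ r + γ}
        + ℓ (c * γ) := by
  -- `robustErrSet p r v` need not be measurable, so it is replaced by its measurable hull.
  set A := toMeasurable D (robustErrSet p r v) with hA
  set F := {s : (Fin d → ℝ) × ℝ | |v ⬝ᵥ s.1| ≤ r + γ}
  have hAm : MeasurableSet A := measurableSet_toMeasurable D _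
  have hFm : MeasurableSet F := by
    refine measurableSet_le ?_ measurable_const
    unfold dotProduct
    fun_prop
  have hAr : D.real A = robustErr D p r v := by
    rw [robustErr, Measure.real, hA, measure_toMeasurable]
    rfl
  have hAi : Integrable (A.indicator fun _ => ℓ 0 + (1 + r) * c) D :=
    (integrable_const _).indicator hAm
  have hFi : Integrable (F.indicator fun _ => ℓ 0) D := (integrable_const _).indicator hFm
  calc ∫ s, ℓ (robustMargin q r (c • v) s) ∂D
      ≤ ∫ s, ((A.indicator (fun _ => ℓ 0 + (1 + r) * c) + F.indicator fun _ => ℓ 0) s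
          + ℓ (c * γ)) ∂D := by
        refine integral_mono_ae (integrable_comp_robustMargin hpq hr hD hℓL _)
          ((hAi.add hFi).add (integrable_const _)) ?_
        filter_upwards [hD] with s hs
        exact hs.loss_robustMargin_smul_le_indicator hpq hr hℓ₀ hℓd hℓL hv hc
          (subset_toMeasurable D _)
    _ = _ := by
        rw [integral_add (hAi.add hFi) (integrable_const _), integral_add' hAi hFi,
          integral_indicator_const _ hAm, integral_indicator_const _ hFm, hAr]
        simp only [smul_eq_mul, integral_const, probReal_univ, one_mul]
        ring

end Comparator

section Guarantee

variable {d n : ℕ} {p q : ℝ≥0∞} {r c γ δ ρ : ℝ} {ℓ : ℝ → ℝ} {v : Fin d → ℝ}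
  {D : Measure ((Fin d → ℝ) × ℝ)} [IsProbabilityMeasure D]

theorem generalizationGap_excessLoss_liftedFeature [Fact (1 ≤ q)] (hd : 0 < d)
    (hpq : p⁻¹ + q⁻¹ = 1) (hr : 0 ≤ r) (hD : ∀ᵐ s ∂D, IsUnitExample p s) (hℓ : LipschitzWith 1 ℓ)
    (S : Fin n → (Fin d → ℝ) × ℝ) (w V : Fin d → ℝ) :
    generalizationGap D S
        (excessLoss ℓ (liftedFeature p r) (liftedWeight p q r V) (liftedWeight p q r w))
      = (∫ s, ℓ (robustMargin q r w s) ∂D - ∫ s, ℓ (robustMargin q r V s) ∂D)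
        - (empiricalRobustRisk ℓ q r S w - empiricalRobustRisk ℓ q r S V) := by
  simp only [generalizationGap, excessLoss, inner_liftedWeight_liftedFeature hd hr,
    empiricalRobustRisk]
  rw [integral_sub (integrable_comp_robustMargin hpq hr hD hℓ w)
    (integrable_comp_robustMargin hpq hr hD hℓ V), Finset.sum_sub_distrib, mul_sub]

theorem exists_measurableSet_integral_sub_empiricalRobustRisk_le [Fact (1 ≤ p)] [Fact (1 ≤ q)]
    (hd : 0 < d) (hn : 0 < n) (hpq : p⁻¹ + q⁻¹ = 1) (hr : 0 ≤ r)
    (hD : ∀ᵐ s ∂D, IsUnitExample p s) (hℓ : LipschitzWith 1 ℓ) (hρ : 0 < ρ) (hδ : 0 < δ)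
    (V : Fin d → ℝ) :
    ∃ E : Set (Fin n → (Fin d → ℝ) × ℝ), MeasurableSet E ∧
      1 - δ ≤ (Measure.pi fun _ : Fin n => D).real E ∧
      ∀ S ∈ E, (∀ i, IsUnitExample p (S i)) ∧ ∀ w, vecNorm 2 (w - V) ≤ ρ →
        (∫ s, ℓ (robustMargin q r w s) ∂D - ∫ s, ℓ (robustMargin q r V s) ∂D)
            - (empiricalRobustRisk ℓ q r S w - empiricalRobustRisk ℓ q r S V)
          ≤ euclideanFactor d p * (1 + r) * ρ * √(8 * Real.log (2 / δ) / n) := by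
  have hC : 0 < euclideanFactor d p := zero_lt_one.trans_le (one_le_euclideanFactor hd)
  have hdev := measureReal_exists_sqrt_log_lt_generalizationGap_le (V := liftedWeight p q r V)
    (ρ := √(1 + r) * ρ) (R := euclideanFactor d p * √(1 + r)) hn hℓ
    (stronglyMeasurable_liftedFeature p r)
    (hD.mono fun s hs => hs.norm_liftedFeature_le hr) (by positivity) (by positivity) hδ
  have hradius : √(1 + r) * ρ * (euclideanFactor d p * √(1 + r))
      = euclideanFactor d p * (1 + r) * ρ := by
    linear_combination euclideanFactor d p * ρ * Real.mul_self_sqrt (by linarith : 0 ≤ 1 + r)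
  rw [hradius] at hdev
  refine exists_measurableSet_of_measureReal_le (le_trans ?_ hdev)
  refine ENNReal.toReal_mono (measure_ne_top _ _) (measure_mono_ae ?_)
  filter_upwards [ae_pi_forall (n := n) hD] with S hS hbad
  by_contra hsmall
  refine hbad ⟨hS, fun w hw => not_lt.1 fun hgap => hsmall ?_⟩
  rw [← generalizationGap_excessLoss_liftedFeature hd hpq hr hD hℓ] at hgap
  exact ⟨_, (norm_liftedWeight_sub_le hd hpq hr w V).trans
    (mul_le_mul_of_nonneg_left hw (Real.sqrt_nonneg _)), hgap⟩

theorem IsAdvTraining.exists_mul_robustErr_le [Fact (1 ≤ p)] [Fact (1 ≤ q)] (hd : 0 < d)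
    (hn : 0 < n) (hpq : p⁻¹ + q⁻¹ = 1) (hr : 0 ≤ r) (hD : ∀ᵐ s ∂D, IsUnitExample p s)
    (hℓ₀ : ∀ t, 0 ≤ ℓ t) (hℓd : Antitone ℓ) (hℓL : LipschitzWith 1 ℓ) {η ε : ℝ} (hη : 0 < η)
    (hε : 0 ≤ ε) (hηε : η * (euclideanFactor d p * (1 + r)) ^ 2 ≤ ε) (hv : vecNorm q v ≤ 1)
    (hc : 0 ≤ c) {S : Fin n → (Fin d → ℝ) × ℝ} (hS : ∀ i, IsUnitExample p (S i)) {N : ℕ}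
    {w : ℕ → Fin d → ℝ} (hw : IsAdvTraining ℓ p r η S N w) (hw₀ : w 0 = 0)
    (hN : vecNorm 2 (c • v) ^ 2 ≤ η * ε * (N + 1)) {t : ℝ}
    (ht : ∀ u, vecNorm 2 (u - c • v) ≤ vecNorm 2 (c • v) →
      (∫ s, ℓ (robustMargin q r u s) ∂D - ∫ s, ℓ (robustMargin q r (c • v) s) ∂D)
        - (empiricalRobustRisk ℓ q r S u - empiricalRobustRisk ℓ q r S (c • v)) ≤ t) :
    ∃ k ≤ N, ℓ 0 * robustErr D p r (w k)
      ≤ (ℓ 0 + (1 + r) * c) * robustErr D p r v + ℓ 0 * D.real {s | |v ⬝ᵥ s.1| ≤ r + γ}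
        + ℓ (c * γ) + ε + t := by
  have hstart : vecNorm 2 (w 0 - c • v) = vecNorm 2 (c • v) := by rw [hw₀, zero_sub, vecNorm_neg]
  obtain ⟨k, hk, hrisk, hdist⟩ := hw.exists_empiricalRobustRisk_le hd hn hpq hr hℓd hℓL hη hε hηε
    hS (V := c • v) (by rwa [hstart])
  have hdev := ht (w k) (hdist.trans_eq hstart)
  have herr := mul_robustErr_le_integral hpq hr hD hℓ₀ hℓd hℓL (w k)
  have hcomparator := integral_loss_robustMargin_smul_le (γ := γ) hpq hr hD hℓ₀ hℓd hℓL hv hc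
  exact ⟨k, hk, by linarith⟩

theorem exists_measurableSet_isAdvTraining_robustErr_le [Fact (1 ≤ p)] [Fact (1 ≤ q)]
    (hd : 0 < d) (hn : 0 < n) (hpq : p⁻¹ + q⁻¹ = 1) (hr : 0 ≤ r)
    (hD : ∀ᵐ s ∂D, IsUnitExample p s) (hℓ₀ : ∀ t, 0 ≤ ℓ t) (hℓpos : 0 < ℓ 0) (hℓd : Antitone ℓ)
    (hℓL : LipschitzWith 1 ℓ) {η ε : ℝ} (hη : 0 < η) (hε : 0 ≤ ε)
    (hηε : η * (euclideanFactor d p * (1 + r)) ^ 2 ≤ ε) (hv : vecNorm q v = 1) {z : ℝ} (hz : 0 < z)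
    (hγ : 0 < γ) (hδ : 0 < δ) {N : ℕ}
    (hN : ((d : ℝ) ^ |(q⁻¹).toReal - 1 / 2| * (z / γ)) ^ 2 ≤ η * ε * (N + 1)) :
    ∃ E : Set (Fin n → (Fin d → ℝ) × ℝ), MeasurableSet E ∧
      1 - δ ≤ (Measure.pi fun _ : Fin n => D).real E ∧
      ∀ S ∈ E, ∀ w : ℕ → Fin d → ℝ, w 0 = 0 → IsAdvTraining ℓ p r η S N w →
        ∃ k ≤ N, robustErr D p r (w k)
          ≤ (1 + (ℓ 0)⁻¹ * (1 + r) * z * γ⁻¹) * robustErr D p r v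
            + D.real {s | |v ⬝ᵥ s.1| ≤ r + γ} + (ℓ 0)⁻¹ * (ℓ z + ε)
            + (ℓ 0)⁻¹ * ((d : ℝ) ^ |(q⁻¹).toReal - 1 / 2| * (1 + r) * γ⁻¹ * z
                * √(8 * Real.log (2 / δ) / n)) := by
  have hc : 0 < z / γ := div_pos hz hγ
  set V := (z / γ) • v
  have hVq : vecNorm q V = z / γ := by rw [vecNorm_smul, hv, abs_of_pos hc, mul_one]
  have hV₀ : 0 < vecNorm 2 V := by
    refine pos_of_mul_pos_right (hc.trans_le ?_) (euclideanFactor_nonneg d p)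
    exact hVq.symm.trans_le (vecNorm_le_euclideanFactor_mul_vecNorm_two hpq _)
  have hV : euclideanFactor d p * vecNorm 2 V ≤ (d : ℝ) ^ |(q⁻¹).toReal - 1 / 2| * (z / γ) :=
    (euclideanFactor_mul_vecNorm_two_le hd hpq _).trans_eq (by rw [hVq])
  have hV₂ : vecNorm 2 V ≤ (d : ℝ) ^ |(q⁻¹).toReal - 1 / 2| * (z / γ) :=
    (le_mul_of_one_le_left hV₀.le (one_le_euclideanFactor hd)).trans hV
  obtain ⟨E, hE, hEδ, hgood⟩ :=
    exists_measurableSet_integral_sub_empiricalRobustRisk_le hd hn hpq hr hD hℓL hV₀ hδ V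
  refine ⟨E, hE, hEδ, fun S hS w hw₀ hw => ?_⟩
  obtain ⟨k, hk, herr⟩ := hw.exists_mul_robustErr_le (γ := γ) hd hn hpq hr hD hℓ₀ hℓd hℓL hη hε hηε
    hv.le hc.le (hgood S hS).1 hw₀ ((pow_le_pow_left₀ hV₀.le hV₂ 2).trans hN) (hgood S hS).2
  refine ⟨k, hk, ((le_inv_mul_iff₀ hℓpos).2 herr).trans ?_⟩
  have hdev : euclideanFactor d p * (1 + r) * vecNorm 2 V * √(8 * Real.log (2 / δ) / n)
      ≤ (d : ℝ) ^ |(q⁻¹).toReal - 1 / 2| * (z / γ) * (1 + r) * √(8 * Real.log (2 / δ) / n) := by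
    rw [mul_right_comm _ (1 + r)]
    gcongr
  refine (mul_le_mul_of_nonneg_left (add_le_add_right hdev _) (inv_nonneg.2 hℓpos.le)).trans_eq ?_
  rw [div_mul_cancel₀ z hγ.ne']
  field_simp
  ring

theorem measureReal_abs_dotProduct_le_eq_one [Fact (1 ≤ q)] (hpq : p⁻¹ + q⁻¹ = 1)
    (hD : ∀ᵐ s ∂D, IsUnitExample p s) (hv : vecNorm q v = 1) {t : ℝ} (ht : 1 ≤ t) :
    D.real {s | |v ⬝ᵥ s.1| ≤ t} = 1 := by
  rw [← probReal_univ (μ := D)]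
  refine measureReal_congr (Filter.eventuallyEq_univ.2 (hD.mono fun s hs => ?_))
  exact ((abs_dotProduct_le_vecNorm hpq hs.1 v).trans_eq hv).trans ht

theorem pos_of_vecNorm_eq_one [Fact (1 ≤ q)] (hv : vecNorm q v = 1) : 0 < d := by
  rcases d.eq_zero_or_pos with rfl | hd
  · have hzero : v = (0 : ℝ) • v := Subsingleton.elim _ _
    rw [hzero, vecNorm_smul, abs_zero, zero_mul] at hv
    exact absurd hv zero_ne_one
  · exact hd

theorem mul_euclideanFactor_sq_le [Fact (1 ≤ p)] (hd : 0 < d) {H ε η : ℝ}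
    (hH : H = if p ≤ 2 then 4 else 4 * (d : ℝ)) (hη : 0 < η) (hηε : η ≤ ε * H⁻¹ / 4)
    (hr : 0 ≤ r) (hr₁ : r ≤ 1) : η * (euclideanFactor d p * (1 + r)) ^ 2 ≤ ε := by
  have hd' : (0 : ℝ) < d := Nat.cast_pos.2 hd
  have hH₀ : 0 < H := by rw [hH]; split_ifs <;> positivity
  have hCH : 4 * euclideanFactor d p ^ 2 ≤ H :=
    (mul_le_mul_of_nonneg_left (euclideanFactor_sq_le hd) zero_le_four).trans_eq (by
      rw [hH, mul_ite, mul_one])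
  have hηH : η * H ≤ ε / 4 := by
    rwa [mul_div_right_comm, ← div_eq_mul_inv, le_div_iff₀ hH₀] at hηε
  have hsq : (1 + r) ^ 2 ≤ 4 := by nlinarith
  calc η * (euclideanFactor d p * (1 + r)) ^ 2
      = η * (euclideanFactor d p ^ 2 * (1 + r) ^ 2) := by rw [mul_pow]
    _ ≤ η * (euclideanFactor d p ^ 2 * 4) := by gcongr
    _ ≤ η * H := by rw [mul_comm _ 4]; gcongr
    _ ≤ ε := by linarith [mul_pos hη hH₀]

end Guarantee

section Comparison

theorem sqrt_eight_mul_log_div_le (n : ℕ) (K : ℝ) {δ : ℝ} (hδ : 0 < δ) :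
    √(8 * Real.log (2 / δ) / n) ≤ 3 * √(Real.log (2 * max 1 K / δ) / n) := by
  have hlog : Real.log (2 / δ) ≤ Real.log (2 * max 1 K / δ) := by
    have : (2 : ℝ) ≤ 2 * max 1 K := le_mul_of_one_le_right zero_le_two (le_max_left _ _)
    gcongr
  have hsqrt : √8 ≤ 3 := Real.sqrt_le_iff.2 ⟨by norm_num, by norm_num⟩
  rw [mul_div_assoc, Real.sqrt_mul (by norm_num)]
  gcongr

variable {d n : ℕ} {p q : ℝ≥0∞}

theorem SoftMargin.measureReal_le {D : Measure ((Fin d → ℝ) × ℝ)} [IsProbabilityMeasure D]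
    {v : Fin d → ℝ} {φ : ℝ → ℝ} (h : SoftMargin D q v φ) {t : ℝ} (ht : 0 ≤ t)
    (hφ : 1 < t → 1 ≤ φ t) : D.real {s | |v ⬝ᵥ s.1| ≤ t} ≤ φ t := by
  rcases le_or_gt t 1 with ht₁ | ht₁
  · exact h.2 t ⟨ht, ht₁⟩
  · exact measureReal_le_one.trans (hφ ht₁)

theorem rademacherNorm_nonneg [Fact (1 ≤ p)] (x : Fin n → Fin d → ℝ) : 0 ≤ rademacherNorm p x :=
  mul_nonneg (by positivity)
    (mul_nonneg (by positivity) (Finset.sum_nonneg fun _ _ => vecNorm_nonneg _))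

theorem deviation_le_rademacher_bound [Fact (1 ≤ p)] (x : Fin n → Fin d → ℝ)
    {a B B' L K r z γ δ : ℝ} (ha : 0 ≤ a) (hL : 0 ≤ L) (hr : 0 ≤ r) (hz : 0 ≤ z) (hγ : 0 < γ)
    (hδ : 0 < δ) (hB : B = L + 2 * a * (1 + r) * γ⁻¹ * z) (hB' : B' = 2 * a * B) :
    L⁻¹ * (a * (1 + r) * γ⁻¹ * z * √(8 * Real.log (2 / δ) / n))
      ≤ 4 * L⁻¹ * B' * γ⁻¹ * z * rademacherNorm p x
        + L⁻¹ * (4 * B' * γ⁻¹ * z * r / √n + 6 * B * √(Real.log (2 * max 1 K / δ) / n)) := by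
  have hcoeff₀ : 0 ≤ a * (1 + r) * γ⁻¹ * z := by positivity
  have hcoeff : a * (1 + r) * γ⁻¹ * z ≤ 2 * B := by linarith
  have hB₀ : 0 ≤ B := by linarith
  have hB'₀ : 0 ≤ B' := by rw [hB']; positivity
  have hR : 0 ≤ rademacherNorm p x := rademacherNorm_nonneg x
  have hdev : a * (1 + r) * γ⁻¹ * z * √(8 * Real.log (2 / δ) / n)
      ≤ 6 * B * √(Real.log (2 * max 1 K / δ) / n) := calc
    _ ≤ 2 * B * (3 * √(Real.log (2 * max 1 K / δ) / n)) :=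
      mul_le_mul hcoeff (sqrt_eight_mul_log_div_le n K hδ) (Real.sqrt_nonneg _) (by positivity)
    _ = 6 * B * √(Real.log (2 * max 1 K / δ) / n) := by ring
  refine le_add_of_nonneg_of_le (by positivity) (mul_le_mul_of_nonneg_left ?_ (by positivity))
  exact le_add_of_nonneg_of_le (by positivity) hdev

end Comparison

theorem theorem1_general {d n : ℕ} (hn : 0 < n)
    (D : Measure ((Fin d → ℝ) × ℝ)) [IsProbabilityMeasure D]
    (p q : ℝ≥0∞) (hpq : p⁻¹ + q⁻¹ = 1)
    (hy : ∀ᵐ s ∂D, s.2 = 1 ∨ s.2 = -1)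
    (hx : ∀ᵐ s ∂D, vecNorm p s.1 ≤ 1)
    (ℓ : ℝ → ℝ) (hℓ0 : ∀ t, 0 ≤ ℓ t) (hℓd : Antitone ℓ) (hℓL : LipschitzWith 1 ℓ)
    (r : ℝ) (hr : 0 ≤ r)
    (v : Fin d → ℝ) (hv : vecNorm q v = 1)
    (H : ℝ) (hH : H = if p ≤ 2 then 4 else 4 * (d : ℝ))
    (ε : ℝ) (hε : 0 < ε) (η : ℝ) (hη : 0 < η) (hηε : η ≤ ε * H⁻¹ / 4)
    (γ : ℝ) (hγ : 0 < γ) (δ : ℝ) (hδ : 0 < δ)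
    (z : ℝ) (hz : 0 ≤ z) (hℓz : ℓ z = ε)
    (K : ℝ) (hK : K = (d : ℝ) ^ |2 * (q⁻¹).toReal - 1| * ε⁻¹ * η⁻¹ * z ^ 2 * (γ ^ 2)⁻¹) :
    ∃ E : Set (Fin n → (Fin d → ℝ) × ℝ), MeasurableSet E ∧
      1 - δ ≤ (Measure.pi (fun _ : Fin n => D)).real E ∧
      ∀ S ∈ E, ∀ w : ℕ → Fin d → ℝ, w 0 = 0 → IsAdvTraining ℓ p r η S ⌊K⌋₊ w →
        ∃ k : ℕ, (k : ℝ) ≤ K ∧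
          robustErr D p r (w k) ≤
            (1 + (ℓ 0)⁻¹ * (1 + r) * z * γ⁻¹) * robustErr D p r v
            + D.real {s | |v ⬝ᵥ s.1| ≤ r + γ} + 2 * (ℓ 0)⁻¹ * ε
            + (ℓ 0)⁻¹ * ((d : ℝ) ^ |(q⁻¹).toReal - 1 / 2| * (1 + r) * γ⁻¹ * z
                * √(8 * Real.log (2 / δ) / n)) := by
  have : Fact (1 ≤ p) := ⟨one_le_of_inv_add_inv_eq_one hpq⟩
  have : Fact (1 ≤ q) := ⟨one_le_of_inv_add_inv_eq_one (add_comm p⁻¹ q⁻¹ ▸ hpq)⟩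
  have hd : 0 < d := pos_of_vecNorm_eq_one hv
  have hD : ∀ᵐ s ∂D, IsUnitExample p s := by
    filter_upwards [hy, hx] with s hys hxs using ⟨hxs, (abs_eq zero_le_one).2 hys⟩
  have hℓpos : 0 < ℓ 0 := hε.trans_le (hℓz ▸ hℓd hz)
  have hK₀ : 0 ≤ K := by rw [hK]; positivity
  have herr₀ : 0 ≤ robustErr D p r v := measureReal_nonneg
  set m := D.real {s : (Fin d → ℝ) × ℝ | |v ⬝ᵥ s.1| ≤ r + γ} with hm
  set a := (d : ℝ) ^ |(q⁻¹).toReal - 1 / 2| with ha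
  by_cases htriv : 1 ≤ m + (ℓ 0)⁻¹ * ε
  · refine ⟨Set.univ, MeasurableSet.univ, by simp [hδ.le], fun S _ w _ _ => ⟨0, by simpa, ?_⟩⟩
    have herr : robustErr D p r (w 0) ≤ 1 := measureReal_le_one
    have : 0 ≤ (1 + (ℓ 0)⁻¹ * (1 + r) * z * γ⁻¹) * robustErr D p r v + (ℓ 0)⁻¹ * ε
      + (ℓ 0)⁻¹ * (a * (1 + r) * γ⁻¹ * z * √(8 * Real.log (2 / δ) / n)) := by positivity
    linarith
  have hz₀ : 0 < z := hz.lt_of_ne' fun h => htriv <| by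
    rw [← hℓz, h, inv_mul_cancel₀ hℓpos.ne']
    exact le_add_of_nonneg_left measureReal_nonneg
  have hr₁ : r ≤ 1 := by
    by_contra! h
    refine htriv ?_
    rw [hm, measureReal_abs_dotProduct_le_eq_one hpq hD hv (by linarith)]
    exact le_add_of_nonneg_right (by positivity)
  have hN : (a * (z / γ)) ^ 2 ≤ η * ε * (⌊K⌋₊ + 1) := calc
    (a * (z / γ)) ^ 2 = η * ε * K := by rw [hK, rpow_abs_two_mul_sub_one, ← ha]; field_simp
    _ ≤ η * ε * (⌊K⌋₊ + 1) := by gcongr; exact (Nat.lt_floor_add_one K).le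
  obtain ⟨E, hE, hEδ, hgood⟩ := exists_measurableSet_isAdvTraining_robustErr_le hd hn hpq hr hD hℓ0
    hℓpos hℓd hℓL hη hε.le (mul_euclideanFactor_sq_le hd hH hη hηε hr hr₁) hv hz₀ hγ hδ hN
  refine ⟨E, hE, hEδ, fun S hS w hw₀ hw => ?_⟩
  obtain ⟨k, hk, herr⟩ := hgood S hS w hw₀ hw
  refine ⟨k, (Nat.cast_le.2 hk).trans (Nat.floor_le hK₀), ?_⟩
  rwa [hℓz, ← two_mul, mul_left_comm, ← mul_assoc] at herr

theorem theorem1 {d n : ℕ} (hn : 0 < n)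
    -- the distribution of labelled examples
    (D : Measure ((Fin d → ℝ) × ℝ)) [IsProbabilityMeasure D]
    (p q : ℝ≥0∞) (hpq : p⁻¹ + q⁻¹ = 1)
    (hy : ∀ᵐ s ∂D, s.2 = 1 ∨ s.2 = -1)
    (hx : ∀ᵐ s ∂D, vecNorm p s.1 ≤ 1)
    -- the loss
    (ℓ : ℝ → ℝ) (hℓ0 : ∀ t, 0 ≤ ℓ t) (hℓc : ConvexOn ℝ Set.univ ℓ)
    (hℓd : Antitone ℓ) (hℓL : LipschitzWith 1 ℓ)
    (r : ℝ) (hr : 0 ≤ r)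
    -- an optimal robust halfspace and its soft margin function
    (v : Fin d → ℝ) (φ : ℝ → ℝ) (hφ : SoftMargin D q v φ)
    (hv : robustErr D p r v = robustOpt D p q r)
    -- accuracy, step size, margin, confidence
    (H : ℝ) (hH : H = if p ≤ 2 then 4 else 4 * (d : ℝ))
    (ε : ℝ) (hε : 0 < ε) (η : ℝ) (hη : 0 < η) (hηε : η ≤ ε * H⁻¹ / 4)
    (γ : ℝ) (hγ : 0 < γ) (hφγ : 1 < r + γ → 1 ≤ φ (r + γ))
    (δ : ℝ) (hδ : 0 < δ)
    -- `z` is `ℓ⁻¹ ε`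
    (z : ℝ) (hz : 0 ≤ z) (hℓz : ℓ z = ε)
    -- the number of iterations and the constants of the bound
    (K : ℝ) (hK : K = (d : ℝ) ^ |2 * (q⁻¹).toReal - 1| * ε⁻¹ * η⁻¹ * z ^ 2 * (γ ^ 2)⁻¹)
    (B : ℝ) (hB : B = ℓ 0 + 2 * (d : ℝ) ^ |(q⁻¹).toReal - 1 / 2| * (1 + r) * γ⁻¹ * z)
    (B' : ℝ) (hB' : B' = 2 * (d : ℝ) ^ |(q⁻¹).toReal - 1 / 2| * B) :
    ∃ E : Set (Fin n → (Fin d → ℝ) × ℝ), MeasurableSet E ∧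
      1 - δ ≤ (Measure.pi (fun _ : Fin n => D)).real E ∧
      ∀ S ∈ E, ∀ w : ℕ → Fin d → ℝ, w 0 = 0 → IsAdvTraining ℓ p r η S ⌊K⌋₊ w →
        ∃ k : ℕ, (k : ℝ) ≤ K ∧
          robustErr D p r (w k) ≤
            (1 + (ℓ 0)⁻¹ * (1 + r) * z * γ⁻¹) * robustOpt D p q r
            + φ (r + γ) + 2 * (ℓ 0)⁻¹ * ε
            + 4 * (ℓ 0)⁻¹ * B' * γ⁻¹ * z * rademacherNorm p (fun i => (S i).1)
            + (ℓ 0)⁻¹ * (4 * B' * γ⁻¹ * z * r / √n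
                + 6 * B * √(Real.log (2 * max 1 K / δ) / n)) := by
  have : Fact (1 ≤ p) := ⟨one_le_of_inv_add_inv_eq_one hpq⟩
  obtain ⟨E, hE, hEδ, hgood⟩ := theorem1_general hn D p q hpq hy hx ℓ hℓ0 hℓd hℓL r hr v hφ.1 H hH
    ε hε η hη hηε γ hγ δ hδ z hz hℓz K hK
  refine ⟨E, hE, hEδ, fun S hS w hw₀ hw => ?_⟩
  obtain ⟨k, hk, herr⟩ := hgood S hS w hw₀ hw
  have hmass := hφ.measureReal_le (by positivity) hφγ
  have hdev := deviation_le_rademacher_bound (p := p) (K := K) (fun i => (S i).1) (by positivity)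
    (hℓ0 0) hr hz hγ hδ hB hB'
  exact ⟨k, hk, by rw [hv] at herr; linarith⟩
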